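/- Let $\Lambda$ be a Nakayama algebra, i.e. an artin algebra (an algebra over a commutative artinian ring $k$ that is finitely generated as a $k$-module) such that all indecomposable projective left modules and all indecomposable projective right modules are uniserial, and assume that no simple left $\Lambda$-module is projective. Modules are left $\Lambda$-modules of finite length. An indecomposable projective module $P$ is called minimal projective if no proper non-zero submodule of $P$ is projective. A module $M$ is called Gorenstein projective if there is an exact complex $(P_i,\delta_i\colon P_i\to P_{i-1})_{i\in\mathbb Z}$ of projective modules such that the complex $\operatorname{Hom}_\Lambda(P_\bullet,\Lambda)$ is also exact and $M\cong\operatorname{Im}(\delta_0)$. A minimal projective resolution of $M$ is an exact sequence $\cdots\to P_1\to P_0\to M\to 0$ with all $P_n$ projective in which $P_0\to M$ and each $P_{n+1}\to\operatorname{Im}(P_{n+1}\to P_n)$ are projective covers. Let $M$ be an indecomposable non-projective $\Lambda$-module. Then the following assertions are equivalent: (i) $M$ is Gorenstein projective. (ii) All the modules $P_n$ ($n\ge 0$) in every minimal projective resolution of $M$ are minimal projective (in particular non-zero). (ii$'$) $M$ has a minimal projective resolution in which all the non-zero modules $P_n$ are minimal projective. (iii) There are an integer $n\ge 1$ and an exact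 sequence $$0\to M\to P_{n-1}\to\cdots\to P_0\to M\to 0$$ such that all the modules $P_i$ are minimal projective. -/

import Mathlib

universe u v

namespace NakayamaGP

/-- A module is indecomposable if it is non-zero and is not the direct sum of two non-zero
submodules. -/
def IsIndecomposable (R : Type u) [Ring R] (M : Type v) [AddCommGroup M] [Module R M] : Prop :=
  Nontrivial M ∧ ∀ A B : Submodule R M, IsCompl A B → A = ⊥ ∨ B = ⊥

/-- A module is uniserial if its submodules form a chain. -/
def IsUniserial (R : Type u) [Ring R] (M : Type v) [AddCommGroup M] [Module R M] : Prop :=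
  ∀ A B : Submodule R M, A ≤ B ∨ B ≤ A

/-- Every indecomposable projective left `R`-module of finite length is uniserial. -/
def IsSerialOnLeft (R : Type u) [Ring R] : Prop :=
  ∀ (P : Type u) [AddCommGroup P] [Module R P], IsFiniteLength R P → Module.Projective R P →
    IsIndecomposable R P → IsUniserial R P

/-- `Λ` is a Nakayama algebra over `k`: it is an artin `k`-algebra (`k` is a commutative artinian
ring and `Λ` is finitely generated as a `k`-module), and all indecomposable projective left
modules and all indecomposable projective right modules are uniserial
(right `Λ`-modules are left modules over the opposite ring). -/
structure IsNakayamaAlgebra (k : Type v) (Λ : Type u) [CommRing k] [Ring Λ] [Algebra k Λ] :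
    Prop where
  artinian : IsArtinianRing k
  finite : Module.Finite k Λ
  left : IsSerialOnLeft Λ
  right : IsSerialOnLeft Λᵐᵒᵖ

/-- No simple left module is projective. -/
def NoSimpleProjective (R : Type u) [Ring R] : Prop :=
  ∀ (S : Type u) [AddCommGroup S] [Module R S], IsSimpleModule R S → ¬ Module.Projective R S

/-- An indecomposable projective module (of finite length) is minimal projective if none of its
proper non-zero submodules is projective. -/
structure IsMinimalProjective (R : Type u) [Ring R] (P : Type v) [AddCommGroup P] [Module R P] :
    Prop where
  finiteLength : IsFiniteLength R P
  projective : Module.Projective R P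
  indecomposable : IsIndecomposable R P
  minimal : ∀ N : Submodule R P, N ≠ ⊥ → N ≠ ⊤ → ¬ Module.Projective R N

/-- A superfluous (small) submodule. -/
def IsSuperfluous {R : Type u} [Ring R] {M : Type v} [AddCommGroup M] [Module R M]
    (K : Submodule R M) : Prop :=
  ∀ N : Submodule R M, K ⊔ N = ⊤ → N = ⊤

/-- A minimal projective resolution `⋯ → P 2 → P 1 → P 0 → M → 0` by modules of finite length:
an exact sequence with all `P n` projective such that `P 0 → M` and all the maps
`P (n + 1) → Im (d n)` are projective covers, i.e. surjections with superfluous kernel. -/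
structure MinimalProjectiveResolution (R : Type u) [Ring R] (M : Type u) [AddCommGroup M]
    [Module R M] where
  P : ℕ → ModuleCat.{u} R
  d : ∀ n, P (n + 1) →ₗ[R] P n
  ε : P 0 →ₗ[R] M
  finiteLength : ∀ n, IsFiniteLength R (P n)
  projective : ∀ n, Module.Projective R (P n)
  surjective : Function.Surjective ε
  exact_zero : Function.Exact (d 0) ε
  exact_succ : ∀ n, Function.Exact (d (n + 1)) (d n)
  minimal_zero : IsSuperfluous (LinearMap.ker ε)
  minimal_succ : ∀ n, IsSuperfluous (LinearMap.ker (d n))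

/-- A complete projective resolution: an exact complex `(P i, d i)`, `i ∈ ℤ`, of projective modules
of finite length such that also the complex `Hom(P, R)` is exact. -/
structure CompleteProjectiveResolution (R : Type u) [Ring R] where
  P : ℤ → ModuleCat.{u} R
  d : ∀ i, P i →ₗ[R] P (i - 1)
  finiteLength : ∀ i, IsFiniteLength R (P i)
  projective : ∀ i, Module.Projective R (P i)
  exact : ∀ i, Function.Exact (d i) (d (i - 1))
  exact_hom : ∀ i, Function.Exact
    (fun g : P (i - 1 - 1) →ₗ[R] R => g ∘ₗ d (i - 1))
    (fun g : P (i - 1) →ₗ[R] R => g ∘ₗ d i)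

/-- `M` is Gorenstein projective if it is (isomorphic to) the image of the map `d 0` of some
complete projective resolution. -/
def IsGorensteinProjective (R : Type u) [Ring R] (M : Type u) [AddCommGroup M] [Module R M] :
    Prop :=
  ∃ C : CompleteProjectiveResolution R, Nonempty (M ≃ₗ[R] LinearMap.range (C.d 0))

/-- There is an exact sequence `0 → M → P_{n-1} → ⋯ → P_0 → M → 0` with `n ≥ 1` and all `P_i`
minimal projective. It is written as
`0 → X (n + 1) → X n → ⋯ → X 1 → X 0 → 0`, where `X 0` and `X (n + 1)` are copies of `M`
and `X (i + 1) = P_i` for `i < n`; the values of `X` and `f` beyond these play no role. -/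
def HasPeriodicMinimalProjectiveSequence (R : Type u) [Ring R] (M : Type u) [AddCommGroup M]
    [Module R M] : Prop :=
  ∃ (n : ℕ) (X : ℕ → ModuleCat.{u} R) (f : ∀ i, X (i + 1) →ₗ[R] X i),
    1 ≤ n ∧
    Nonempty (X 0 ≃ₗ[R] M) ∧ Nonempty (X (n + 1) ≃ₗ[R] M) ∧
    (∀ i < n, IsMinimalProjective R (X (i + 1))) ∧
    Function.Surjective (f 0) ∧
    (∀ i < n, Function.Exact (f (i + 1)) (f i)) ∧
    Function.Injective (f n)

end NakayamaGP

/-! A Nakayama algebra is artinian and serial on both sides, and three consequences carry the proof.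
Write an indecomposable projective as `T = Re`. Since `Hom(T, R) = eR` is uniserial, of two maps
from `T` to indecomposable projectives one factors through the other (`exists_factorization`). A
length count then extends maps between local modules, which makes every indecomposable module
uniserial (`IsIndecomposable.isUniserial`). Finally, maps to `R` extend from any submodule of a
minimal projective module (`IsMinimalProjective.exists_extension`).

Gorenstein projectivity gives `Ext^n(M, R) = 0` for `n ≥ 1`. With this vanishing the projective
cover of `M` is minimal projective, and the syzygy is again indecomposable, non-projective and
orthogonal to `R` (`IsStableOrthogonal.isMinimalProjective_and_ker`), so all terms of the resolution
are minimal projective.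

Conversely, if the non-zero terms are minimal projective, no syzygy is zero or projective. Up to
isomorphism only finitely many modules are quotients of indecomposable projectives, so two syzygies
are isomorphic; a module with minimal projective cover is determined by its syzygy, so the
isomorphism descends to `M` itself and the resolution is periodic. Repeating a period in both
directions gives an exact complex, and the extension property makes its dual exact. -/

namespace NakayamaGP

/-! ### Uniserial modules, projective covers, decompositions -/

section Basic

variable {R : Type u} [Ring R] {M N P : Type u} [AddCommGroup M] [Module R M]
  [AddCommGroup N] [Module R N] [AddCommGroup P] [Module R P]

theorem IsUniserial.of_injective (h : IsUniserial R N) (f : M →ₗ[R] N)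
    (hf : Function.Injective f) : IsUniserial R M := fun A B => by
  have := h (A.map f) (B.map f)
  rwa [Submodule.map_le_map_iff_of_injective hf, Submodule.map_le_map_iff_of_injective hf] at this

theorem IsUniserial.of_surjective (h : IsUniserial R M) (f : M →ₗ[R] N)
    (hf : Function.Surjective f) : IsUniserial R N := fun A B => by
  have := h (A.comap f) (B.comap f)
  rwa [Submodule.comap_le_comap_iff_of_surjective hf,
    Submodule.comap_le_comap_iff_of_surjective hf] at this

theorem IsUniserial.eq_bot_of_disjoint (h : IsUniserial R M) {A B : Submodule R M}
    (hA : A ≠ ⊥) (hAB : Disjoint A B) : B = ⊥ := by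
  rcases h A B with h | h
  · exact absurd (hAB.eq_bot_of_le h) hA
  · exact hAB.symm.eq_bot_of_le h

theorem IsUniserial.isIndecomposable [Nontrivial M] (h : IsUniserial R M) :
    IsIndecomposable R M :=
  ⟨‹_›, fun A B hAB => by
    by_cases hA : A = ⊥
    · exact .inl hA
    · exact .inr (h.eq_bot_of_disjoint hA hAB.disjoint)⟩

theorem IsUniserial.injective_of_injOn (h : IsUniserial R M) {A : Submodule R M} (hA : A ≠ ⊥)
    (f : M →ₗ[R] N) (hf : Function.Injective (f ∘ₗ A.subtype)) : Function.Injective f := by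
  rw [← LinearMap.ker_eq_bot]
  refine h.eq_bot_of_disjoint hA (Submodule.disjoint_def.2 fun x hx hx' => ?_)
  have := @hf ⟨x, hx⟩ 0 (by simpa using hx')
  simpa using this

theorem isFiniteLength_of_finite [IsArtinianRing R] [Module.Finite R M] : IsFiniteLength R M :=
  isFiniteLength_iff_isNoetherian_isArtinian.2 ⟨inferInstance, inferInstance⟩

theorem _root_.IsFiniteLength.isNoetherian (h : IsFiniteLength R M) : IsNoetherian R M :=
  (isFiniteLength_iff_isNoetherian_isArtinian.1 h).1

theorem _root_.IsFiniteLength.isArtinian (h : IsFiniteLength R M) : IsArtinian R M :=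
  (isFiniteLength_iff_isNoetherian_isArtinian.1 h).2

theorem _root_.IsFiniteLength.submodule (h : IsFiniteLength R M) (A : Submodule R M) :
    IsFiniteLength R A := h.of_injective A.injective_subtype

/-- A surjection from an indecomposable module onto a non-zero projective module is bijective. -/
theorem IsIndecomposable.bijective_of_surjective (h : IsIndecomposable R M) [Nontrivial N]
    [Module.Projective R N] (f : M →ₗ[R] N) (hf : Function.Surjective f) :
    Function.Bijective f := by
  obtain ⟨s, hs⟩ := Module.projective_lifting_property f LinearMap.id hf
  have hs' : ∀ x, f (s x) = x := fun x => LinearMap.congr_fun hs x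
  have hc : IsCompl (LinearMap.ker f) (LinearMap.range s) := by
    constructor
    · rw [Submodule.disjoint_def]
      rintro _ hx ⟨y, rfl⟩
      rw [LinearMap.mem_ker, hs'] at hx
      rw [hx, map_zero]
    · rw [codisjoint_iff, eq_top_iff]
      intro x _
      have := Submodule.add_mem_sup (S := LinearMap.ker f) (T := LinearMap.range s)
        (s := x - s (f x)) (t := s (f x)) (by simp [hs']) ⟨_, rfl⟩
      simpa using this
  refine ⟨?_, hf⟩
  rcases h.2 _ _ hc with h' | h'
  · exact LinearMap.ker_eq_bot.1 h'
  · rw [LinearMap.range_eq_bot] at h'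
    obtain ⟨x, hx⟩ := exists_ne (0 : N)
    exact absurd (by rw [← hs' x, h']; simp) hx

/-- If `f : M → N` has superfluous kernel and `N` is uniserial and non-zero,
then `M` is indecomposable. -/
theorem isIndecomposable_of_isSuperfluous_ker [Nontrivial N] (hN : IsUniserial R N)
    (f : M →ₗ[R] N) (hf : Function.Surjective f) (hk : IsSuperfluous (LinearMap.ker f)) :
    IsIndecomposable R M := by
  have key : ∀ A B : Submodule R M, IsCompl A B → A.map f ≤ B.map f → A = ⊥ := by
    intro A B hAB hle
    have h1 : B.map f = ⊤ := by
      have := congrArg (Submodule.map f) hAB.sup_eq_top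
      rwa [Submodule.map_sup, Submodule.map_top, LinearMap.range_eq_top.2 hf,
        sup_eq_right.2 hle] at this
    have h2 : B = ⊤ := by
      refine hk B ?_
      rw [sup_comm, ← Submodule.comap_map_eq, h1, Submodule.comap_top]
    exact hAB.disjoint.eq_bot_of_le (h2 ▸ le_top)
  refine ⟨hf.nontrivial, fun A B hAB => ?_⟩
  rcases hN (A.map f) (B.map f) with h | h
  · exact .inl (key A B hAB h)
  · exact .inr (key B A hAB.symm h)

theorem IsSuperfluous.ne_top [Nontrivial M] {K : Submodule R M} (h : IsSuperfluous K) :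
    K ≠ ⊤ := fun hK => bot_ne_top (h ⊥ (by simp [hK]))

/-- Modules of finite length over an artinian ring have projective covers. -/
theorem exists_projectiveCover [IsArtinianRing R] (hM : IsFiniteLength R M) :
    ∃ (P : ModuleCat.{u} R) (f : P →ₗ[R] M), IsFiniteLength R P ∧ Module.Projective R P ∧
      Function.Surjective f ∧ IsSuperfluous (LinearMap.ker f) := by
  classical
  have := hM.isNoetherian
  -- A projective module of least length mapping onto `M` is a cover: if `N + ker f = P`, lifting
  -- `f` through `N` gives an endomorphism `e` with image in `N` and `f e = f`. By Fitting, the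
  -- image of a high power of `e` is a summand still mapping onto `M`, hence all of `P`.
  let S : Set ℕ∞ := {l | ∃ (P : ModuleCat.{u} R) (f : P →ₗ[R] M), IsFiniteLength R P ∧
    Module.Projective R P ∧ Function.Surjective f ∧ Module.length R P = l}
  have hS : S.Nonempty := by
    obtain ⟨n, f, hf⟩ := Module.Finite.exists_fin' R M
    exact ⟨_, ModuleCat.of R (Fin n → R), f, isFiniteLength_of_finite,
      inferInstanceAs (Module.Projective R (Fin n → R)), hf, rfl⟩
  obtain ⟨P, f, hP, hproj, hf, hl⟩ := WellFounded.min_mem wellFounded_lt S hS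
  refine ⟨P, f, hP, hproj, hf, fun N hN => ?_⟩
  have := hP.isNoetherian
  have := hP.isArtinian
  have hfN : Function.Surjective (f ∘ₗ N.subtype) := by
    rw [← LinearMap.range_eq_top, LinearMap.range_comp, Submodule.range_subtype]
    have := congrArg (Submodule.map f) hN
    rw [Submodule.map_sup, Submodule.map_top, LinearMap.range_eq_top.2 hf] at this
    rw [← this, (LinearMap.le_ker_iff_map (f := f)).1 le_rfl, bot_sup_eq]
  obtain ⟨φ, hφ⟩ := Module.projective_lifting_property (f ∘ₗ N.subtype) f hfN
  let e : Module.End R P := N.subtype ∘ₗ φ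
  have he : ∀ x, f (e x) = f x := fun x => LinearMap.congr_fun hφ x
  have hen : ∀ n x, f ((e ^ n) x) = f x := by
    intro n
    induction n with
    | zero => simp
    | succ n ih => intro x; rw [pow_succ', Module.End.mul_apply, he, ih]
  obtain ⟨n, hn⟩ := Filter.eventually_atTop.1 (LinearMap.eventually_isCompl_ker_pow_range_pow e)
  -- A positive exponent ensures that the image of the power lies in `N`.
  specialize hn (n + 1) (Nat.le_succ n)
  set Q := LinearMap.range (e ^ (n + 1)) with hQ
  have hQproj : Module.Projective R Q :=
    Module.Projective.of_split Q.subtype (Q.projectionOnto _ hn.symm)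
      (by ext x; simp)
  have hQf : Function.Surjective (f ∘ₗ Q.subtype) := fun y => by
    obtain ⟨x, rfl⟩ := hf y
    exact ⟨⟨_, x, rfl⟩, hen (n + 1) x⟩
  have hQtop : Q = ⊤ := by
    by_contra hne
    have h1 := Submodule.length_lt hne
    rw [hl] at h1
    exact WellFounded.not_lt_min wellFounded_lt S
      ⟨ModuleCat.of R Q, f ∘ₗ Q.subtype, hP.submodule Q, hQproj, hQf, rfl⟩ h1
  rw [eq_top_iff, ← hQtop]
  rintro _ ⟨x, rfl⟩
  rw [pow_succ', Module.End.mul_apply]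
  exact (φ _).2

/-- A non-zero uniserial module of finite length has a largest proper submodule. -/
theorem IsUniserial.exists_greatest_ne_top [Nontrivial M] (h : IsUniserial R M)
    (hM : IsFiniteLength R M) :
    ∃ m : Submodule R M, m ≠ ⊤ ∧ ∀ A : Submodule R M, A ≠ ⊤ → A ≤ m := by
  have := hM.isNoetherian
  obtain ⟨m, hm, -⟩ := IsCoatomic.eq_top_or_exists_le_coatom (⊥ : Submodule R M) |>.resolve_left
    bot_ne_top
  refine ⟨m, hm.1, fun A hA => ?_⟩
  rcases h A m with h' | h'
  · exact h'
  · exact ((hm.le_iff.1 h').resolve_left hA).le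

/-- A non-zero uniserial module of finite length is cyclic. -/
theorem IsUniserial.exists_span_eq_top [Nontrivial M] (h : IsUniserial R M)
    (hM : IsFiniteLength R M) : ∃ x : M, Submodule.span R {x} = ⊤ := by
  obtain ⟨m, hm, hm'⟩ := h.exists_greatest_ne_top hM
  obtain ⟨x, hx⟩ := SetLike.exists_not_mem_of_ne_top m hm rfl
  refine ⟨x, ?_⟩
  by_contra hne
  exact hx (hm' _ hne (Submodule.mem_span_singleton_self x))

theorem IsUniserial.exists_retract [Nontrivial M] (h : IsUniserial R M)
    (hM : IsFiniteLength R M) [Module.Projective R M] :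
    ∃ (i : M →ₗ[R] R) (r : R →ₗ[R] M), r ∘ₗ i = LinearMap.id := by
  obtain ⟨x, hx⟩ := h.exists_span_eq_top hM
  have hs : Function.Surjective (LinearMap.toSpanSingleton R M x) := by
    rw [← LinearMap.range_eq_top, ← LinearMap.span_singleton_eq_range, hx]
  obtain ⟨i, hi⟩ := Module.projective_lifting_property _ (LinearMap.id : M →ₗ[R] M) hs
  exact ⟨i, _, hi⟩

/-- Induction principle for complemented submodules of artinian modules. -/
theorem induction_of_isCompl [IsArtinian R M] (p : Submodule R M → Prop) (bot : p ⊥)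
    (indec : ∀ A B : Submodule R M, IsCompl A B → IsIndecomposable R A → p A)
    (sup : ∀ A B C : Submodule R M, IsCompl A (B ⊔ C) → p A → p B → p (A ⊔ B)) :
    p ⊤ := by
  suffices ∀ A : Submodule R M, (∃ B, IsCompl A B) → p A from this ⊤ ⟨⊥, isCompl_top_bot⟩
  intro A
  induction A using WellFoundedLT.induction with
  | ind A ih =>
  rintro ⟨B, hB⟩
  by_cases hA : A = ⊥
  · rwa [hA]
  by_cases hi : IsIndecomposable R A
  · exact indec A B hB hi
  have hnt : Nontrivial A := Submodule.nontrivial_iff_ne_bot.2 hA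
  simp only [IsIndecomposable, hnt, true_and, not_forall, not_or] at hi
  obtain ⟨C, D, hCD, hC, hD⟩ := hi
  have hinj := A.injective_subtype
  have hsup : C.map A.subtype ⊔ D.map A.subtype = A := by
    rw [← Submodule.map_sup, hCD.sup_eq_top, Submodule.map_subtype_top]
  have hdis : Disjoint (C.map A.subtype) (D.map A.subtype) :=
    Submodule.disjoint_map hinj hCD.disjoint
  have hC' : C.map A.subtype ≠ ⊥ := by
    rw [← Submodule.map_bot A.subtype]
    exact (Submodule.map_injective_of_injective hinj).ne hC
  have hD' : D.map A.subtype ≠ ⊥ := by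
    rw [← Submodule.map_bot A.subtype]
    exact (Submodule.map_injective_of_injective hinj).ne hD
  have key : ∀ E F : Submodule R M, E ⊔ F = A → Disjoint E F → F ≠ ⊥ →
      E < A ∧ IsCompl E (F ⊔ B) := by
    intro E F hs hd hF
    refine ⟨lt_of_le_of_ne (hs ▸ le_sup_left) ?_, ?_, ?_⟩
    · rintro rfl
      exact hF (hd.symm.eq_bot_of_le (sup_eq_left.1 hs))
    · refine hd.disjoint_sup_right_of_disjoint_sup_left ?_
      rw [hs]
      exact hB.disjoint
    · rw [codisjoint_iff, ← sup_assoc, hs, hB.sup_eq_top]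
  rw [← hsup]
  obtain ⟨h1, h2⟩ := key _ _ hsup hdis hD'
  obtain ⟨h3, h4⟩ := key _ _ ((sup_comm _ _).trans hsup) hdis.symm hC'
  exact sup _ _ B h2 (ih _ h1 ⟨_, h2⟩) (ih _ h3 ⟨_, h4⟩)

theorem projective_of_isCompl [Module.Projective R M] {A B : Submodule R M} (h : IsCompl A B) :
    Module.Projective R A :=
  Module.Projective.of_split A.subtype (A.projectionOnto _ h) (by ext x; simp)

end Basic

/-! ### Comparing maps between indecomposable projectives -/

section Factorization

variable {R : Type u} [Ring R]

/-- The opposite ring acting on itself from the left is the ring acted on from the right. -/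
def opSelfEquiv (R : Type u) [Ring R] : Rᵐᵒᵖ ≃ₗ[Rᵐᵒᵖ] R where
  toFun := MulOpposite.unop
  invFun := MulOpposite.op
  map_add' _ _ := rfl
  map_smul' _ _ := rfl
  left_inv _ := rfl
  right_inv _ := rfl

/-- If `R e` is indecomposable, where `e = i (r 1)` is the idempotent of a retract `T` of `R`,
then so is the right module `e R`. -/
theorem isIndecomposable_rightIdeal {T : Type u} [AddCommGroup T] [Module R T]
    (hT : IsIndecomposable R T) (i : T →ₗ[R] R) (r : R →ₗ[R] T) (hri : r ∘ₗ i = LinearMap.id) :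
    IsIndecomposable Rᵐᵒᵖ
      (LinearMap.range (DistribSMul.toLinearMap Rᵐᵒᵖ R (i (r 1)))) := by
  have hri' : ∀ t, r (i t) = t := fun t => LinearMap.congr_fun hri t
  set e := i (r 1) with he
  have hir : ∀ x, i (r x) = x * e := fun x => by
    rw [he, ← smul_eq_mul, ← map_smul, ← map_smul, smul_eq_mul, mul_one]
  have hee : e * e = e := by rw [← hir, he, hri']
  have hie : ∀ t, i t * e = i t := fun t => by rw [← hir, hri']
  set E := LinearMap.range (DistribSMul.toLinearMap Rᵐᵒᵖ R e) with hE
  have hEe : ∀ x : E, e * (x : R) = x := by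
    rintro ⟨_, y, rfl⟩
    change e * (e * y) = e * y
    rw [← mul_assoc, hee]
  have heE : e ∈ E := ⟨e, hee⟩
  have hzero : ∀ a : R, e * a = a → (∀ t, r (i t * a) = 0) → a * e = a → a = 0 := by
    intro a h1 h2 h3
    have := h2 (r 1)
    rw [← he, h1] at this
    rw [← h3, ← hir, this, map_zero]
  refine ⟨⟨⟨⟨e, heE⟩, 0, fun h => ?_⟩⟩, fun A B hAB => ?_⟩
  · have h0 : e = 0 := congrArg Subtype.val h
    obtain ⟨t, ht⟩ := @exists_ne _ hT.1 (0 : T)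
    apply ht
    rw [← hri' t, ← hie t, h0, mul_zero, map_zero]
  -- The components of `e` in `A` and `B` turn out to be orthogonal idempotents. Right
  -- multiplication by them decomposes `T`, so one of them vanishes, and with it its summand.
  obtain ⟨a, ha, b, hb, hab⟩ := Submodule.mem_sup.1
    (show (⟨e, heE⟩ : E) ∈ A ⊔ B by rw [hAB.sup_eq_top]; trivial)
  have hab' : (a : R) + b = e := congrArg Subtype.val hab
  have hmul : ∀ (C : Submodule Rᵐᵒᵖ E) (x : E) (y : R), x ∈ C →
      ∃ z ∈ C, (z : R) = x * y := fun C x y hx => ⟨MulOpposite.op y • x, C.smul_mem _ hx, rfl⟩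
  have hdis : ∀ x ∈ A, ∀ y ∈ B, (x : R) = y → (x : R) = 0 := by
    intro x hx y hy hxy
    have : x = y := Subtype.ext hxy
    have := Submodule.disjoint_def.1 hAB.disjoint x hx (this ▸ hy)
    rw [this]; rfl
  have hba : (b : R) * a = 0 := by
    obtain ⟨z, hz, hz'⟩ := hmul A a a ha
    obtain ⟨w, hw, hw'⟩ := hmul B b a hb
    have h1 := hEe a
    rw [← hab', add_mul] at h1
    have h2 : ((a - z : E) : R) = w := by
      rw [Submodule.coe_sub, hz', hw']
      exact (eq_sub_of_add_eq' h1).symm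
    rw [← hw', ← h2]
    exact hdis _ (A.sub_mem ha hz) w hw h2
  have hab0 : (a : R) * b = 0 := by
    obtain ⟨z, hz, hz'⟩ := hmul B b b hb
    obtain ⟨w, hw, hw'⟩ := hmul A a b ha
    have h1 := hEe b
    rw [← hab', add_mul] at h1
    rw [← hw']
    refine hdis w hw _ (B.sub_mem hb hz) ?_
    rw [Submodule.coe_sub, hz', hw']
    exact eq_sub_of_add_eq h1
  have haa : (a : R) * a = a := by
    have h1 := hEe a
    rwa [← hab', add_mul, hba, add_zero] at h1
  have hbb : (b : R) * b = b := by
    have h1 := hEe b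
    rwa [← hab', add_mul, hab0, zero_add] at h1
  have hae : (a : R) * e = a := by rw [← hab', mul_add, haa, hab0, add_zero]
  have hbe : (b : R) * e = b := by rw [← hab', mul_add, hbb, hba, zero_add]
  -- Right multiplication by `x`, compressed to the retract `T` of `R`.
  let φ : R → T →ₗ[R] T := fun x => r ∘ₗ LinearMap.toSpanSingleton R R x ∘ₗ i
  have hφ : ∀ x t, φ x t = r (i t * x) := fun _ _ => rfl
  have hiφ : ∀ x t, i (φ x t) = i t * x * e := fun x t => by rw [hφ, hir]
  have hadd : ∀ t, φ a t + φ b t = t := fun t => by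
    rw [hφ, hφ, ← map_add, ← mul_add, hab', hie, hri']
  have h1 : ∀ t, φ a (φ b t) = 0 := fun t => by
    rw [hφ, hiφ, mul_assoc, mul_assoc, hEe, hba, mul_zero, map_zero]
  have h2 : ∀ t, φ b (φ a t) = 0 := fun t => by
    rw [hφ, hiφ, mul_assoc, mul_assoc, hEe, hab0, mul_zero, map_zero]
  have hc : IsCompl (LinearMap.ker (φ a)) (LinearMap.ker (φ b)) := by
    constructor
    · rw [Submodule.disjoint_def]
      intro t h h'
      rw [← hadd t, LinearMap.mem_ker.1 h, LinearMap.mem_ker.1 h', add_zero]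
    · rw [codisjoint_iff, eq_top_iff]
      intro t _
      rw [← hadd t, add_comm]
      exact Submodule.add_mem_sup (h1 t) (h2 t)
  rcases hT.2 _ _ hc with h | h
  · right
    have hb0 : (b : R) = 0 := hzero b (hEe b)
      (fun t => LinearMap.ker_eq_bot'.1 h _ (h1 t)) hbe
    rw [Submodule.eq_bot_iff]
    intro x hx
    obtain ⟨w, hw, hw'⟩ := hmul A a x ha
    refine Subtype.ext ((hEe x).symm.trans ?_)
    rw [← hab', hb0, add_zero, ← hw']
    refine hdis w hw x hx ?_
    rw [hw', ← add_zero (a : R), ← hb0, hab', hEe]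
  · left
    have ha0 : (a : R) = 0 := hzero a (hEe a)
      (fun t => LinearMap.ker_eq_bot'.1 h _ (h2 t)) hae
    rw [Submodule.eq_bot_iff]
    intro x hx
    obtain ⟨w, hw, hw'⟩ := hmul B b x hb
    refine Subtype.ext (hdis x hx w hw ?_)
    rw [hw', ← zero_add (b : R), ← ha0, hab', hEe]

/-- Over a serial artinian ring, of two maps from an indecomposable projective module to
indecomposable projective modules, one factors through the other. -/
theorem exists_factorization [IsArtinianRing R] [IsArtinianRing Rᵐᵒᵖ] (hl : IsSerialOnLeft R)
    (hr : IsSerialOnLeft Rᵐᵒᵖ) {T P Q : Type u} [AddCommGroup T] [Module R T] [AddCommGroup P]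
    [Module R P] [AddCommGroup Q] [Module R Q] (hT : IsIndecomposable R T)
    (hP : IsIndecomposable R P) (hQ : IsIndecomposable R Q) (hT' : IsFiniteLength R T)
    (hP' : IsFiniteLength R P) (hQ' : IsFiniteLength R Q) [Module.Projective R T]
    [Module.Projective R P] [Module.Projective R Q] (α : T →ₗ[R] Q) (β : T →ₗ[R] P) :
    (∃ γ : Q →ₗ[R] P, γ ∘ₗ α = β) ∨ ∃ γ : P →ₗ[R] Q, γ ∘ₗ β = α := by
  have := hT.1
  have := hP.1
  have := hQ.1
  obtain ⟨i, r, hri⟩ := (hl T hT' ‹_› hT).exists_retract hT'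
  obtain ⟨iP, rP, hriP⟩ := (hl P hP' ‹_› hP).exists_retract hP'
  obtain ⟨iQ, rQ, hriQ⟩ := (hl Q hQ' ‹_› hQ).exists_retract hQ'
  have hri' : ∀ t, r (i t) = t := fun t => LinearMap.congr_fun hri t
  have hE := isIndecomposable_rightIdeal hT i r hri
  have hir : ∀ x, i (r x) = x * i (r 1) := fun x => by
    rw [← smul_eq_mul, ← map_smul, ← map_smul, smul_eq_mul, mul_one]
  have hee : i (r 1) * i (r 1) = i (r 1) := by rw [← hir, hri']
  -- Evaluation at `r 1` identifies `Hom(T, R)` with `eR`, and composing with an endomorphism of `R`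
  -- becomes right multiplication. Comparing cyclic submodules of the uniserial module `eR` thus
  -- compares maps to `R`; `P` and `Q` are retracts of `R`.
  have hmem : ∀ f : T →ₗ[R] R,
      f (r 1) ∈ LinearMap.range (DistribSMul.toLinearMap Rᵐᵒᵖ R (i (r 1))) := fun f => by
    refine ⟨f (r 1), ?_⟩
    change i (r 1) • f (r 1) = f (r 1)
    rw [← map_smul, ← map_smul, smul_eq_mul, mul_one, hri']
  set e := i (r 1) with he
  set E := LinearMap.range (DistribSMul.toLinearMap Rᵐᵒᵖ R e)
  have hRproj : Module.Projective Rᵐᵒᵖ R := Module.Projective.of_equiv (opSelfEquiv R)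
  have hRfl : IsFiniteLength Rᵐᵒᵖ R := (opSelfEquiv R).isFiniteLength isFiniteLength_of_finite
  have hEproj : Module.Projective Rᵐᵒᵖ E := by
    refine Module.Projective.of_split E.subtype (LinearMap.rangeRestrict _) ?_
    ext ⟨_, y, rfl⟩
    change e * (e * y) = e * y
    rw [← mul_assoc, hee]
  have huni := hr E (hRfl.submodule E) hEproj hE
  have key : ∀ f g : T →ₗ[R] R, (⟨g (r 1), hmem g⟩ : E) ∈
      Submodule.span Rᵐᵒᵖ {(⟨f (r 1), hmem f⟩ : E)} → ∃ c : R →ₗ[R] R, c ∘ₗ f = g := by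
    intro f g h
    obtain ⟨c, hc⟩ := Submodule.mem_span_singleton.1 h
    have hc' : f (r 1) * c.unop = g (r 1) := congrArg Subtype.val hc
    refine ⟨LinearMap.toSpanSingleton R R c.unop, LinearMap.ext fun t => ?_⟩
    change f t * c.unop = g t
    have ht : t = i t • r 1 := by rw [← map_smul, smul_eq_mul, mul_one, hri']
    rw [ht, map_smul, map_smul, smul_eq_mul, mul_assoc, hc', smul_eq_mul]
  rcases huni (Submodule.span Rᵐᵒᵖ {⟨(iP ∘ₗ β) (r 1), hmem _⟩})
    (Submodule.span Rᵐᵒᵖ {⟨(iQ ∘ₗ α) (r 1), hmem _⟩}) with h | h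
  · obtain ⟨c, hc⟩ := key (iQ ∘ₗ α) (iP ∘ₗ β) (h (Submodule.mem_span_singleton_self _))
    refine .inl ⟨rP ∘ₗ c ∘ₗ iQ, ?_⟩
    rw [LinearMap.comp_assoc, LinearMap.comp_assoc, hc, ← LinearMap.comp_assoc, hriP,
      LinearMap.id_comp]
  · obtain ⟨c, hc⟩ := key (iP ∘ₗ β) (iQ ∘ₗ α) (h (Submodule.mem_span_singleton_self _))
    refine .inr ⟨rQ ∘ₗ c ∘ₗ iP, ?_⟩
    rw [LinearMap.comp_assoc, LinearMap.comp_assoc, hc, ← LinearMap.comp_assoc, hriQ,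
      LinearMap.id_comp]

end Factorization

/-- An indecomposable projective module of finite length. -/
structure IsIndecProj (R : Type u) [Ring R] (P : Type u) [AddCommGroup P] [Module R P] :
    Prop where
  finiteLength : IsFiniteLength R P
  projective : Module.Projective R P
  indecomposable : IsIndecomposable R P

/-- A left and right artinian ring which is left and right serial. -/
structure IsSerialArtinian (R : Type u) [Ring R] : Prop where
  artinian : IsArtinianRing R
  artinian_op : IsArtinianRing Rᵐᵒᵖ
  left : IsSerialOnLeft R
  right : IsSerialOnLeft Rᵐᵒᵖ

theorem IsNakayamaAlgebra.isSerialArtinian {k : Type v} {Λ : Type u} [CommRing k] [Ring Λ]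
    [Algebra k Λ] (h : IsNakayamaAlgebra k Λ) : IsSerialArtinian Λ := by
  have := h.artinian
  have := h.finite
  have : Module.Finite k Λᵐᵒᵖ := Module.Finite.equiv (MulOpposite.opLinearEquiv k)
  exact ⟨isArtinian_of_tower k inferInstance, isArtinian_of_tower k inferInstance,
    h.left, h.right⟩

/-! ### Indecomposable modules are uniserial -/

section Uniserial

variable {R : Type u} [Ring R]

theorem IsMinimalProjective.isIndecProj {P : Type u} [AddCommGroup P] [Module R P]
    (h : IsMinimalProjective R P) : IsIndecProj R P :=
  ⟨h.finiteLength, h.projective, h.indecomposable⟩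

variable {M N P Q T U W : Type u}
  [AddCommGroup M] [Module R M] [AddCommGroup N] [Module R N] [AddCommGroup P] [Module R P]
  [AddCommGroup Q] [Module R Q] [AddCommGroup T] [Module R T] [AddCommGroup U] [Module R U]
  [AddCommGroup W] [Module R W]

theorem IsIndecProj.isUniserial (hR : IsSerialArtinian R)
    (hP : IsIndecProj R P) : IsUniserial R P :=
  hR.left P hP.finiteLength hP.projective hP.indecomposable

theorem IsIndecProj.exists_factorization (hR : IsSerialArtinian R)
    (hT : IsIndecProj R T) (hP : IsIndecProj R P)
    (hQ : IsIndecProj R Q) (α : T →ₗ[R] Q) (β : T →ₗ[R] P) :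
    (∃ γ : Q →ₗ[R] P, γ ∘ₗ α = β) ∨ ∃ γ : P →ₗ[R] Q, γ ∘ₗ β = α := by
  have := hR.artinian
  have := hR.artinian_op
  have := hT.projective
  have := hP.projective
  have := hQ.projective
  exact NakayamaGP.exists_factorization hR.left hR.right hT.indecomposable hP.indecomposable
    hQ.indecomposable hT.finiteLength hP.finiteLength hQ.finiteLength α β

theorem IsUniserial.exists_indecProj (hR : IsSerialArtinian R) [Nontrivial M] (h : IsUniserial R M)
    (hM : IsFiniteLength R M) :
    ∃ (T : ModuleCat.{u} R) (t : T →ₗ[R] M), IsIndecProj R T ∧ Function.Surjective t := by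
  have := hR.artinian
  obtain ⟨T, t, h1, h2, h3, h4⟩ := exists_projectiveCover hM
  exact ⟨T, t, ⟨h1, h2, isIndecomposable_of_isSuperfluous_ker h t h3 h4⟩, h3⟩

/-- Every module over an artinian ring is generated by images of indecomposable projectives. -/
theorem exists_indecProj_not_le (hR : IsSerialArtinian R) {N : Submodule R M} (hN : N ≠ ⊤) :
    ∃ (Q : ModuleCat.{u} R) (q : Q →ₗ[R] M), IsIndecProj R Q ∧ ¬ LinearMap.range q ≤ N := by
  have := hR.artinian
  by_contra! H
  obtain ⟨m, hm⟩ := SetLike.exists_not_mem_of_ne_top N hN rfl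
  have key : (⊤ : Submodule R R).map (LinearMap.toSpanSingleton R M m) ≤ N := by
    refine induction_of_isCompl (fun A => A.map (LinearMap.toSpanSingleton R M m) ≤ N) (by simp)
      (fun A B hAB hA => ?_) (fun A B _ _ hA hB => ?_)
    · have := H (ModuleCat.of R A) (LinearMap.toSpanSingleton R M m ∘ₗ A.subtype)
        ⟨IsFiniteLength.submodule isFiniteLength_of_finite A, projective_of_isCompl hAB, hA⟩
      rwa [LinearMap.range_comp, Submodule.range_subtype] at this
    · rw [Submodule.map_sup]
      exact sup_le hA hB
  exact hm (key ⟨1, trivial, by simp⟩)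

/-- The quotient of `P` by `B` can be computed after a surjection whose kernel lies in `B`. -/
theorem length_quotient_map {p : P →ₗ[R] U} (hp : Function.Surjective p) {B : Submodule R P}
    (hB : LinearMap.ker p ≤ B) : Module.length R (P ⧸ B) = Module.length R (U ⧸ B.map p) := by
  have hk : LinearMap.ker ((B.map p).mkQ ∘ₗ p) = B := by
    rw [LinearMap.ker_comp, Submodule.ker_mkQ, Submodule.comap_map_eq, sup_eq_left.2 hB]
  have e := ((B.map p).mkQ ∘ₗ p).quotKerEquivOfSurjective
    ((B.map p).mkQ_surjective.comp hp)
  rw [hk] at e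
  exact e.length_eq

/-- The map `γ` embeds `P ⧸ B` as the proper submodule `γ(P) ⧸ γ(B)`. -/
theorem length_quotient_map_lt {γ : P →ₗ[R] Q} (hγ : LinearMap.range γ ≠ ⊤)
    (hQ : IsFiniteLength R Q) {B : Submodule R P} (hB : LinearMap.ker γ ≤ B) :
    Module.length R (P ⧸ B) < Module.length R (Q ⧸ B.map γ) := by
  have := hQ.isNoetherian
  have := hQ.isArtinian
  have hk : LinearMap.ker ((B.map γ).mkQ ∘ₗ γ) = B := by
    rw [LinearMap.ker_comp, Submodule.ker_mkQ, Submodule.comap_map_eq, sup_eq_left.2 hB]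
  have e := ((B.map γ).mkQ ∘ₗ γ).quotKerEquivRange
  rw [hk] at e
  rw [e.length_eq]
  refine Submodule.length_lt fun h => hγ ?_
  have h' := congrArg (Submodule.comap (B.map γ).mkQ) h
  rw [LinearMap.range_comp, Submodule.comap_map_eq, Submodule.ker_mkQ, Submodule.comap_top] at h'
  rwa [sup_eq_left.2 (LinearMap.map_le_range)] at h'

/-- A map factoring through `α` extends a map given on the image of `α` modulo `ker q`. -/
theorem exists_extension_of_comp_eq (hQ : IsUniserial R Q) {p : P →ₗ[R] U} {q : Q →ₗ[R] W}
    (hq : Function.Surjective q) {V : Submodule R W} (hV : V ≠ ⊥) {g : V →ₗ[R] U} {t : T →ₗ[R] V}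
    (ht : Function.Surjective t) {α : T →ₗ[R] Q} {β : T →ₗ[R] P}
    (hα : q ∘ₗ α = V.subtype ∘ₗ t) (hβ : p ∘ₗ β = g ∘ₗ t) {γ : Q →ₗ[R] P} (hγ : γ ∘ₗ α = β) :
    ∃ h : W →ₗ[R] U, h ∘ₗ V.subtype = g := by
  have hα' : ∀ x, q (α x) = t x := fun x => LinearMap.congr_fun hα x
  have hβ' : ∀ x, p (β x) = g (t x) := fun x => LinearMap.congr_fun hβ x
  have hγ' : ∀ x, γ (α x) = β x := fun x => LinearMap.congr_fun hγ x
  -- Otherwise `q α` would vanish and `V` would be zero. Hence `p γ` is known on `ker q`: there it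
  -- agrees with `g t` at points where `t` is zero, so it descends to `W`.
  have hle : LinearMap.ker q ≤ LinearMap.range α := by
    refine (hQ _ _).resolve_right fun h => hV ?_
    rw [Submodule.eq_bot_iff]
    intro v hv
    obtain ⟨x, hx⟩ := ht ⟨v, hv⟩
    have := h ⟨x, rfl⟩
    rwa [LinearMap.mem_ker, hα', hx] at this
  have hker : LinearMap.ker q ≤ LinearMap.ker (p ∘ₗ γ) := by
    intro z hz
    obtain ⟨x, rfl⟩ := hle hz
    rw [LinearMap.mem_ker, hα', ZeroMemClass.coe_eq_zero] at hz
    rw [LinearMap.mem_ker, LinearMap.comp_apply, hγ', hβ', hz, map_zero]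
  refine ⟨(LinearMap.ker q).liftQ (p ∘ₗ γ) hker ∘ₗ
    (q.quotKerEquivOfSurjective hq).symm.toLinearMap, LinearMap.ext fun v => ?_⟩
  obtain ⟨x, rfl⟩ := ht v
  have : (q.quotKerEquivOfSurjective hq).symm (t x : W) = Submodule.Quotient.mk (α x) := by
    rw [LinearEquiv.symm_apply_eq, LinearMap.quotKerEquivOfSurjective_apply_mk, hα']
  simp [this, hγ', hβ']

/-- Let `U` and `W` be local modules over a serial ring and assume that `U` is at least as long
as `W`. Then maps into `U` from submodules of `W` extend to `W`. -/
theorem exists_extension_of_length_le (hR : IsSerialArtinian R)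
    (hP : IsIndecProj R P) (hQ : IsIndecProj R Q)
    {p : P →ₗ[R] U} (hp : Function.Surjective p) {q : Q →ₗ[R] W} (hq : Function.Surjective q)
    (hle : Module.length R W ≤ Module.length R U) {V : Submodule R W} (g : V →ₗ[R] U) :
    ∃ h : W →ₗ[R] U, h ∘ₗ V.subtype = g := by
  by_cases hg : g = 0
  · exact ⟨0, by rw [hg]; rfl⟩
  have hV : V ≠ ⊥ := by
    rintro rfl
    exact hg (Subsingleton.elim _ _)
  have hnt : Nontrivial V := Submodule.nontrivial_iff_ne_bot.2 hV
  have hQu := hQ.isUniserial hR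
  have hPu := hP.isUniserial hR
  have hWfl : IsFiniteLength R W := hQ.finiteLength.of_surjective hq
  obtain ⟨T, t, hT, ht⟩ := IsUniserial.exists_indecProj hR
    ((hQu.of_surjective q hq).of_injective V.subtype V.injective_subtype) (hWfl.submodule V)
  have := hT.projective
  obtain ⟨α, hα⟩ := Module.projective_lifting_property q (V.subtype ∘ₗ t) hq
  obtain ⟨β, hβ⟩ := Module.projective_lifting_property p (g ∘ₗ t) hp
  -- A factorization `β = γ α` yields the extension, and so does `α = γ β` with `γ` invertible. The
  -- length hypothesis excludes a non-surjective `γ` in the second case.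
  rcases hT.exists_factorization hR hP hQ α β with ⟨γ, hγ⟩ | ⟨γ, hγ⟩
  · exact exists_extension_of_comp_eq hQu hq hV ht hα hβ hγ
  by_cases hs : LinearMap.range γ = ⊤
  · have := hQ.indecomposable.1
    have := hQ.projective
    let e := LinearEquiv.ofBijective γ
      (hP.indecomposable.bijective_of_surjective γ (LinearMap.range_eq_top.1 hs))
    refine exists_extension_of_comp_eq hQu hq hV ht hα hβ (γ := e.symm.toLinearMap) ?_
    ext x
    rw [← hγ]
    exact e.symm_apply_apply (β x)
  exfalso
  have hαV : (LinearMap.range α).map q = V := by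
    rw [← LinearMap.range_comp, hα, LinearMap.range_comp, LinearMap.range_eq_top.2 ht,
      Submodule.map_top, Submodule.range_subtype]
  have hβg : (LinearMap.range β).map p = LinearMap.range g := by
    rw [← LinearMap.range_comp, hβ, LinearMap.range_comp, LinearMap.range_eq_top.2 ht,
      Submodule.map_top]
  have hβα : (LinearMap.range β).map γ = LinearMap.range α := by
    rw [← LinearMap.range_comp, hγ]
  have h1 : LinearMap.ker q ≤ LinearMap.range α :=
    (hQu _ _).resolve_right fun h => hV (by rw [← hαV, ← LinearMap.le_ker_iff_map.1 h])
  have h2 : LinearMap.ker p ≤ LinearMap.range β := (hPu _ _).resolve_right fun h => hg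
    (LinearMap.range_eq_bot.1 (by rw [← hβg, ← LinearMap.le_ker_iff_map.1 h]))
  have h3 : LinearMap.ker γ ≤ LinearMap.range β := (hPu _ _).resolve_right fun h => hV
    (by rw [← hαV, ← hβα, LinearMap.le_ker_iff_map.1 h, Submodule.map_bot])
  -- This becomes `ℓ(U / im g) < ℓ(W / V)`; with `ℓ(im g) ≤ ℓ(V)` it forces `ℓ(U) < ℓ(W)`.
  have h4 := length_quotient_map_lt hs hQ.finiteLength h3
  rw [hβα, length_quotient_map hq h1, length_quotient_map hp h2, hαV, hβg] at h4
  have h5 : Module.length R (LinearMap.range g) ≤ Module.length R V :=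
    Module.length_le_of_surjective g.rangeRestrict g.surjective_rangeRestrict
  have hW := Module.length_eq_add_of_exact V.subtype V.mkQ V.injective_subtype V.mkQ_surjective
    (LinearMap.exact_subtype_mkQ V)
  have hU := Module.length_eq_add_of_exact (LinearMap.range g).subtype (LinearMap.range g).mkQ
    (Submodule.injective_subtype _) (Submodule.mkQ_surjective _)
    (LinearMap.exact_subtype_mkQ _)
  have hVfin : Module.length R V ≠ ⊤ := Module.length_ne_top_iff.2 (hWfl.submodule V)
  rw [hW, hU] at hle
  exact absurd hle (not_le.2 (ENat.add_lt_add_of_le_of_lt (ne_top_of_le_ne_top hVfin h5) h5 h4))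

/-- Indecomposable modules of finite length over a serial artinian ring are uniserial. -/
theorem IsIndecomposable.isUniserial (hR : IsSerialArtinian R)
    (hM : IsIndecomposable R M) (hfl : IsFiniteLength R M) :
    IsUniserial R M := by
  have := hfl.isNoetherian
  have := hfl.isArtinian
  have := hM.1
  obtain ⟨Q₀, q₀, hQ₀, hq₀⟩ := exists_indecProj_not_le hR (M := M) bot_ne_top
  -- Let `U` be a non-zero image in `M` of an indecomposable projective, of maximal length. The
  -- identity of `U` will extend to `M`, so `U` is a non-zero summand and equals `M`.
  let S : Set ℕ := {l | ∃ (P : ModuleCat.{u} R) (p : P →ₗ[R] M), IsIndecProj R P ∧ p ≠ 0 ∧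
    Module.length R (LinearMap.range p) = l}
  have hlen : Module.length R M ≠ ⊤ := Module.length_ne_top
  have hrange : ∀ A : Submodule R M, Module.length R A ≤ Module.length R M := fun A =>
    Module.length_le_of_injective A.subtype A.injective_subtype
  have hcoe : ∀ A : Submodule R M, ((Module.length R A).toNat : ℕ∞) = Module.length R A :=
    fun A => ENat.natCast_toNat (ne_top_of_le_ne_top hlen (hrange A))
  have hS : S.Nonempty := ⟨_, Q₀, q₀, hQ₀, fun h => hq₀ (by simp [h]), (hcoe _).symm⟩
  have hbdd : BddAbove S := by
    refine ⟨(Module.length R M).toNat, ?_⟩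
    rintro l ⟨P, p, -, -, hl⟩
    have h := hrange (LinearMap.range p)
    rw [hl, ← ENat.natCast_toNat hlen] at h
    exact_mod_cast h
  obtain ⟨P, p, hP, hp0, hp⟩ := Nat.sSup_mem hS hbdd
  have hmax : ∀ (Q : ModuleCat.{u} R) (q : Q →ₗ[R] M), IsIndecProj R Q →
      Module.length R (LinearMap.range q) ≤ Module.length R (LinearMap.range p) := by
    intro Q q hQ
    by_cases hq : q = 0
    · have : Subsingleton (LinearMap.range q) := by
        rw [hq, LinearMap.range_zero]
        infer_instance
      rw [Module.length_eq_zero]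
      exact zero_le
    rw [hp, ← hcoe]
    exact_mod_cast le_csSup hbdd ⟨Q, q, hQ, hq, (hcoe _).symm⟩
  set U := LinearMap.range p with hU
  let C : Set (Submodule R M) := {N | ∃ f : M →ₗ.[R] U, f.domain = N ∧
    (⟨U, LinearMap.id⟩ : M →ₗ.[R] U) ≤ f}
  obtain ⟨N, ⟨f, rfl, hf⟩, hN⟩ := WellFounded.has_min (wellFounded_gt (α := Submodule R M)) C
    ⟨U, _, rfl, le_rfl⟩
  have htop : f.domain = ⊤ := by
    -- Take a local submodule `im q` outside the maximal domain. It is no longer than `U`, so `f`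
    -- restricted to the intersection extends to `im q`; gluing enlarges the domain.
    by_contra hne
    obtain ⟨Q, q, hQ, hq⟩ := exists_indecProj_not_le hR hne
    let V : Submodule R (LinearMap.range q) := f.domain.comap (LinearMap.range q).subtype
    obtain ⟨h, hh⟩ := exists_extension_of_length_le hR hP hQ p.surjective_rangeRestrict
      q.surjective_rangeRestrict (hmax Q q hQ)
      (V := V) (f.toFun ∘ₗ ((LinearMap.range q).subtype.restrict (p := V) (q := f.domain)
        fun x hx => hx))
    let f' : M →ₗ.[R] U := ⟨LinearMap.range q, h⟩
    have hagree : ∀ (x : f.domain) (y : f'.domain), (x : M) = y → f x = f' y := by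
      intro x y hxy
      have := LinearMap.congr_fun hh ⟨y, show (y : M) ∈ f.domain from hxy ▸ x.2⟩
      refine Eq.trans ?_ this.symm
      exact congrArg f (Subtype.ext hxy)
    refine hN (f.sup f' hagree).domain ⟨_, rfl, hf.trans (f.left_le_sup f' hagree)⟩ ?_
    refine lt_of_le_of_ne (f.left_le_sup f' hagree).1 fun heq => hq ?_
    rw [heq]
    exact (f.right_le_sup f' hagree).1
  let φ : M →ₗ[R] U := f.toFun ∘ₗ (LinearEquiv.ofTop f.domain htop).symm.toLinearMap
  have hφ : ∀ x : U, φ x = x := fun x => (hf.2 (y := ⟨x, by rw [htop]; trivial⟩) rfl).symm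
  have hUbot : U ≠ ⊥ := fun h => hp0 (LinearMap.range_eq_bot.1 h)
  have hker := (hM.2 _ _ (LinearMap.isCompl_of_proj hφ)).resolve_left hUbot
  have hUtop : U = ⊤ := by
    have := (LinearMap.isCompl_of_proj hφ).sup_eq_top
    rwa [hker, sup_bot_eq] at this
  exact (hP.isUniserial hR).of_surjective p (LinearMap.range_eq_top.1 hUtop)

end Uniserial

/-! ### Extending maps from submodules of minimal projectives; splicing periods -/

section Extension

variable {R : Type u} [Ring R] {P Q : Type u} [AddCommGroup P] [Module R P]
  [AddCommGroup Q] [Module R Q]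

/-- The image is a non-zero projective submodule, so it cannot be proper. -/
theorem IsMinimalProjective.bijective_of_injective (hP : IsMinimalProjective R P)
    [Module.Projective R Q] [Nontrivial Q] (γ : Q →ₗ[R] P) (hγ : Function.Injective γ) :
    Function.Bijective γ := by
  refine ⟨hγ, LinearMap.range_eq_top.1 ?_⟩
  by_contra h
  refine hP.minimal (LinearMap.range γ) (fun h0 => ?_) h
    (Module.Projective.of_equiv (LinearEquiv.ofInjective γ hγ))
  rw [LinearMap.range_eq_bot] at h0
  obtain ⟨x, hx⟩ := exists_ne (0 : Q)
  exact hx (hγ (by simp [h0]))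

/-- Maps from submodules of minimal projective modules to indecomposable projective modules
extend. -/
theorem IsMinimalProjective.exists_extension_indecProj (hR : IsSerialArtinian R)
    (hP : IsMinimalProjective R P) (hQ : IsIndecProj R Q) (N : Submodule R P) (h : N →ₗ[R] Q) :
    ∃ g : P →ₗ[R] Q, g ∘ₗ N.subtype = h := by
  by_cases hN : N = ⊥
  · subst hN
    exact ⟨0, Subsingleton.elim _ _⟩
  have hnt : Nontrivial N := Submodule.nontrivial_iff_ne_bot.2 hN
  have hPu := hP.isIndecProj.isUniserial hR
  obtain ⟨T, t, hT, ht⟩ := IsUniserial.exists_indecProj hR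
    (hPu.of_injective N.subtype N.injective_subtype) (hP.finiteLength.submodule N)
  have htc : ∀ {X : Type u} [AddCommGroup X] [Module R X] (a b : N →ₗ[R] X),
      a ∘ₗ t = b ∘ₗ t → a = b := fun a b hab => (LinearMap.cancel_right ht).1 hab
  rcases hT.exists_factorization hR hQ hP.isIndecProj (N.subtype ∘ₗ t) (h ∘ₗ t) with
    ⟨γ, hγ⟩ | ⟨γ, hγ⟩
  · exact ⟨γ, htc _ _ hγ⟩
  -- In this case `γ` is injective on the non-zero image of `h`, hence injective by uniseriality and
  -- bijective by minimality of `P`; its inverse extends `h`.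
  have hγ' : γ ∘ₗ h = N.subtype := htc _ _ hγ
  have hγx : ∀ x, γ (h x) = x := fun x => LinearMap.congr_fun hγ' x
  have hinj : Function.Injective γ := by
    refine (hQ.isUniserial hR).injective_of_injOn (A := LinearMap.range h) (fun h0 => hN ?_) γ ?_
    · rw [LinearMap.range_eq_bot] at h0
      rw [Submodule.eq_bot_iff]
      intro x hx
      have := hγx ⟨x, hx⟩
      rw [h0] at this
      simpa using this.symm
    · rintro ⟨_, x, rfl⟩ ⟨_, y, rfl⟩ hxy
      have hxy' : γ (h x) = γ (h y) := hxy
      rw [hγx, hγx] at hxy'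
      simp [Subtype.ext hxy']
  have := hQ.projective
  have := hQ.indecomposable.1
  let e := LinearEquiv.ofBijective γ (hP.bijective_of_injective γ hinj)
  refine ⟨e.symm.toLinearMap, LinearMap.ext fun x => ?_⟩
  change e.symm (x : P) = h x
  rw [LinearEquiv.symm_apply_eq]
  exact (hγx x).symm

/-- Maps from submodules of minimal projective modules to the ring extend. -/
theorem IsMinimalProjective.exists_extension (hR : IsSerialArtinian R)
    (hP : IsMinimalProjective R P) (N : Submodule R P) (h : N →ₗ[R] R) :
    ∃ g : P →ₗ[R] R, g ∘ₗ N.subtype = h := by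
  have := hR.artinian
  suffices ∀ h : N →ₗ[R] R, LinearMap.range h ≤ ⊤ → ∃ g : P →ₗ[R] R, g ∘ₗ N.subtype = h from
    this h le_top
  refine induction_of_isCompl (fun A => ∀ h : N →ₗ[R] R, LinearMap.range h ≤ A →
    ∃ g : P →ₗ[R] R, g ∘ₗ N.subtype = h) ?_ ?_ ?_
  · intro h hh
    rw [le_bot_iff, LinearMap.range_eq_bot] at hh
    exact ⟨0, by rw [hh]; rfl⟩
  · intro A B hAB hA h hh
    obtain ⟨g, hg⟩ := hP.exists_extension_indecProj hR
      ⟨IsFiniteLength.submodule isFiniteLength_of_finite A, projective_of_isCompl hAB, hA⟩ N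
      (h.codRestrict A fun x => hh ⟨x, rfl⟩)
    refine ⟨A.subtype ∘ₗ g, ?_⟩
    rw [LinearMap.comp_assoc, hg, LinearMap.subtype_comp_codRestrict]
  · intro A B C hc hA hB h hh
    -- Projecting onto `A` along `B ⊕ C` splits `h` into a part with values in `A` and a part with
    -- values in `B`.
    let π : R →ₗ[R] R := A.subtype ∘ₗ A.projectionOnto _ hc
    obtain ⟨g₁, hg₁⟩ := hA (π ∘ₗ h) (by
      rintro _ ⟨x, rfl⟩
      exact Subtype.prop _)
    obtain ⟨g₂, hg₂⟩ := hB (h - π ∘ₗ h) (by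
      rintro _ ⟨x, rfl⟩
      obtain ⟨a, ha, b, hb, hab⟩ := Submodule.mem_sup.1 (hh ⟨x, rfl⟩)
      have h1 : π a = a := congrArg Subtype.val (Submodule.projectionOnto_apply_left hc ⟨a, ha⟩)
      have h2 : π b = 0 := congrArg Subtype.val
        (Submodule.projectionOnto_apply_of_mem_right hc (Submodule.mem_sup_left hb))
      rw [LinearMap.sub_apply, LinearMap.comp_apply, ← hab, map_add, h1, h2, add_zero,
        add_sub_cancel_left]
      exact hb)
    exact ⟨g₁ + g₂, by rw [LinearMap.add_comp, hg₁, hg₂, add_sub_cancel]⟩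

/-- A periodic exact sequence of minimal projective modules can be spliced to a complete
projective resolution. -/
theorem HasPeriodicMinimalProjectiveSequence.isGorensteinProjective (hR : IsSerialArtinian R)
    {M : Type u} [AddCommGroup M] [Module R M]
    (hM : HasPeriodicMinimalProjectiveSequence R M) : IsGorensteinProjective R M := by
  obtain ⟨n, X, f, hn, ⟨e₀⟩, ⟨e₁⟩, hmin, hsurj, hexact, hinj⟩ := hM
  -- Position `i` of the complex carries the projective with index `i` modulo `n`.
  let r : ℤ → ℕ := fun i => (i % n).toNat
  have hrcast : ∀ i, (r i : ℤ) = i % n := fun i =>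
    Int.toNat_of_nonneg (Int.emod_nonneg i (by omega))
  have hr : ∀ i, r i < n := fun i => by
    have := hrcast i
    have := Int.emod_nonneg i (show (n : ℤ) ≠ 0 by omega)
    have := Int.emod_lt_of_pos i (show (0 : ℤ) < n by omega)
    omega
  have hr_succ : ∀ i, r i = r (i - 1) + 1 ∨ (r i = 0 ∧ r (i - 1) + 1 = n) := by
    intro i
    have := hrcast i
    have := hrcast (i - 1)
    have h1 := Int.emod_nonneg i (show (n : ℤ) ≠ 0 by omega)
    have h2 := Int.emod_lt_of_pos i (show (0 : ℤ) < n by omega)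
    have h3 := Int.emod_nonneg (i - 1) (show (n : ℤ) ≠ 0 by omega)
    have h4 := Int.emod_lt_of_pos (i - 1) (show (0 : ℤ) < n by omega)
    have h5 := Int.emod_add_emod (i - 1) n 1
    rw [sub_add_cancel] at h5
    by_cases h : (i - 1) % n + 1 = n
    · right
      rw [h, Int.emod_self] at h5
      omega
    · left
      rw [Int.emod_eq_of_lt (by omega) (by omega)] at h5
      omega
  -- Inside a period this is the inclusion of an image that equals the next kernel. At the seam, `im
  -- (f 0) = X 0 ≅ M ≅ X (n + 1)` is embedded by `f n`.
  have hι : ∀ i, ∃ ι : LinearMap.range (f (r i)) →ₗ[R] X (r (i - 1) + 1),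
      Function.Injective ι ∧ LinearMap.range ι = LinearMap.ker (f (r (i - 1))) := by
    intro i
    rcases hr_succ i with h | ⟨h, h'⟩
    · rw [h]
      refine ⟨Submodule.subtype _, Submodule.injective_subtype _, ?_⟩
      rw [Submodule.range_subtype]
      exact (hexact _ (hr _)).linearMap_ker_eq.symm
    · have hn' : n = r (i - 1) + 1 := h'.symm
      have hker := (hexact _ (hr (i - 1))).linearMap_ker_eq
      rw [h, hker]
      rw [hn'] at e₁ hinj
      let e : LinearMap.range (f 0) ≃ₗ[R] X (r (i - 1) + 1 + 1) :=
        (LinearEquiv.ofTop _ (LinearMap.range_eq_top.2 hsurj)).trans (e₀.trans e₁.symm)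
      refine ⟨f (r (i - 1) + 1) ∘ₗ e.toLinearMap, hinj.comp e.injective, ?_⟩
      rw [LinearMap.range_comp, LinearEquiv.range, Submodule.map_top]
  choose ι hιinj hιrange using hι
  let d : ∀ i, X (r i + 1) →ₗ[R] X (r (i - 1) + 1) := fun i => ι i ∘ₗ (f (r i)).rangeRestrict
  have hdker : ∀ i, LinearMap.ker (d i) = LinearMap.ker (f (r i)) := fun i => by
    rw [LinearMap.ker_comp_of_ker_eq_bot _ (LinearMap.ker_eq_bot.2 (hιinj i)),
      LinearMap.ker_rangeRestrict]
  have hdrange : ∀ i, LinearMap.range (d i) = LinearMap.range (ι i) := fun i => by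
    rw [LinearMap.range_comp, LinearMap.range_rangeRestrict, Submodule.map_top]
  refine ⟨⟨fun i => X (r i + 1), d, fun i => (hmin _ (hr i)).finiteLength,
    fun i => (hmin _ (hr i)).projective, fun i => ?_, fun i g => ⟨fun hg => ?_, ?_⟩⟩, ?_⟩
  · rw [LinearMap.exact_iff, hdker, hdrange, hιrange]
  · have hle : LinearMap.ker (f (r (i - 1))) ≤ LinearMap.ker g := by
      rw [← hιrange, ← hdrange]
      rintro _ ⟨x, rfl⟩
      exact LinearMap.congr_fun hg x
    have hle' : LinearMap.ker (ι (i - 1) ∘ₗ (f (r (i - 1))).rangeRestrict) ≤ LinearMap.ker g := by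
      change LinearMap.ker (d (i - 1)) ≤ _
      rwa [hdker]
    let g' : LinearMap.range (d (i - 1)) →ₗ[R] R :=
      (LinearMap.ker (d (i - 1))).liftQ g hle' ∘ₗ (d (i - 1)).quotKerEquivRange.symm.toLinearMap
    obtain ⟨g'', hg''⟩ := (hmin _ (hr (i - 1 - 1))).exists_extension hR _ g'
    refine ⟨g'', LinearMap.ext fun x => ?_⟩
    have := LinearMap.congr_fun hg'' ⟨d (i - 1) x, x, rfl⟩
    refine this.trans ?_
    change (LinearMap.ker (d (i - 1))).liftQ g hle' ((d (i - 1)).quotKerEquivRange.symm _) = g x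
    have h : (d (i - 1)).quotKerEquivRange.symm ⟨d (i - 1) x, x, rfl⟩ =
        Submodule.Quotient.mk x := by
      rw [LinearEquiv.symm_apply_eq]
      rfl
    rw [h]
    rfl
  · rintro ⟨g', rfl⟩
    ext x
    change g' (d (i - 1) (d i x)) = 0
    have : d i x ∈ LinearMap.ker (d (i - 1)) := by
      rw [hdker, ← hιrange, ← hdrange]
      exact ⟨x, rfl⟩
    rw [LinearMap.mem_ker.1 this, map_zero]
  · have hr0 : r 0 = 0 := by simp [r]
    have hs : Function.Surjective (f (r 0)) := by rw [hr0]; exact hsurj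
    have e₀' : X (r 0) ≃ₗ[R] M := by rw [hr0]; exact e₀
    refine ⟨?_⟩
    change M ≃ₗ[R] LinearMap.range (d 0)
    rw [hdrange]
    exact e₀'.symm.trans ((LinearEquiv.ofTop _ (LinearMap.range_eq_top.2 hs)).symm.trans
      (LinearEquiv.ofInjective (ι 0) (hιinj 0)))

end Extension

/-! ### Vanishing of `Ext` into the ring -/

section Orthogonal

open CategoryTheory Abelian

/-- `Ext^n(M, R)` vanishes for all `n ≥ 1`. -/
def IsExtOrthogonal (R : Type u) [Ring R] (M : Type u) [AddCommGroup M] [Module R M] : Prop :=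
  ∀ n : ℕ, Subsingleton (Ext (ModuleCat.of R M) (ModuleCat.of R R) (n + 1))

variable {R : Type u} [Ring R] {M P : Type u} [AddCommGroup M] [Module R M]
  [AddCommGroup P] [Module R P]

/-- Dimension shifting: `Ext^(n+1)` of the kernel lies between `Ext^(n+1)(P, R) = 0` and
`Ext^(n+2)(M, R) = 0`. -/
theorem IsExtOrthogonal.ker [Module.Projective R P] (h : IsExtOrthogonal R M) {f : P →ₗ[R] M}
    (hf : Function.Surjective f) : IsExtOrthogonal R (LinearMap.ker f) := by
  intro n
  refine subsingleton_of_forall_eq 0 fun x => ?_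
  have hS := LinearMap.shortExact_shortComplexKer hf
  obtain ⟨y, hy⟩ := Ext.contravariant_sequence_exact₁ hS _ x (n₁ := n + 1 + 1) (by omega)
    ((h (n + 1)).elim _ _)
  rw [← hy, Ext.eq_zero_of_projective y, Ext.comp_zero]

/-- The obstruction to extending `g` is its connecting class in `Ext^1(M, R)`. -/
theorem IsExtOrthogonal.exists_extension (h : IsExtOrthogonal R M) {f : P →ₗ[R] M}
    (hf : Function.Surjective f) (g : LinearMap.ker f →ₗ[R] R) :
    ∃ g' : P →ₗ[R] R, g' ∘ₗ (LinearMap.ker f).subtype = g := by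
  have hS := LinearMap.shortExact_shortComplexKer hf
  obtain ⟨y, hy⟩ := Ext.contravariant_sequence_exact₁ hS _
    (Ext.mk₀ (ModuleCat.ofHom g)) (n₁ := 0 + 1) (by omega) ((h 0).elim _ _)
  obtain ⟨y, rfl⟩ := (Ext.mk₀_bijective _ _).2 y
  rw [Ext.mk₀_comp_mk₀] at hy
  have := (Ext.mk₀_bijective _ _).1 hy
  exact ⟨y.hom, congrArg ModuleCat.Hom.hom this⟩

/-- As `Ext^1(P, R) = 0`, every class in `Ext^1(M, R)` is the connecting class of a map on the
kernel, and this is zero when the map extends to `P`. -/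
theorem subsingleton_ext_one [Module.Projective R P] {f : P →ₗ[R] M} (hf : Function.Surjective f)
    (h : ∀ g : LinearMap.ker f →ₗ[R] R, ∃ g' : P →ₗ[R] R, g' ∘ₗ (LinearMap.ker f).subtype = g) :
    Subsingleton (Ext (ModuleCat.of R M) (ModuleCat.of R R) (0 + 1)) := by
  refine subsingleton_of_forall_eq 0 fun x => ?_
  have hS := LinearMap.shortExact_shortComplexKer hf
  obtain ⟨y, hy⟩ := Ext.contravariant_sequence_exact₃ hS _ x (Ext.eq_zero_of_projective _)
    (n₀ := 0) (by omega)
  obtain ⟨y, rfl⟩ := (Ext.mk₀_bijective _ _).2 y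
  obtain ⟨g, hg⟩ := h y.hom
  have : y = f.shortComplexKer.f ≫ ModuleCat.ofHom g := by
    ext1
    exact hg.symm
  rw [← hy, this, ← Ext.mk₀_comp_mk₀, hS.extClass_comp_assoc]

theorem subsingleton_ext_succ [Module.Projective R P] {f : P →ₗ[R] M}
    (hf : Function.Surjective f) {n : ℕ}
    (h : Subsingleton (Ext (ModuleCat.of R (LinearMap.ker f)) (ModuleCat.of R R) n)) :
    Subsingleton (Ext (ModuleCat.of R M) (ModuleCat.of R R) (n + 1)) := by
  refine subsingleton_of_forall_eq 0 fun x => ?_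
  have hS := LinearMap.shortExact_shortComplexKer hf
  obtain ⟨y, hy⟩ := Ext.contravariant_sequence_exact₃ hS _ x (Ext.eq_zero_of_projective _)
    (n₀ := n) (by omega)
  rw [← hy, h.elim y 0, Ext.comp_zero]

/-- Exactness of the dual complex is exactly the extension property for the kernels. Since `ker (d
i)` is a syzygy of `ker (d (i - 1))`, dimension shifting gives the higher degrees. -/
theorem CompleteProjectiveResolution.subsingleton_ext_ker (C : CompleteProjectiveResolution R)
    (n : ℕ) (i : ℤ) :
    (∀ g : LinearMap.ker (C.d i) →ₗ[R] R, ∃ g' : C.P i →ₗ[R] R,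
      g' ∘ₗ (LinearMap.ker (C.d i)).subtype = g) ∧
    Subsingleton (Ext (ModuleCat.of R (LinearMap.ker (C.d i))) (ModuleCat.of R R) (n + 1)) := by
  have hmem : ∀ i x, C.d i x ∈ LinearMap.ker (C.d (i - 1)) := fun i x =>
    (C.exact i).linearMap_ker_eq ▸ ⟨x, rfl⟩
  let f : ∀ i, C.P i →ₗ[R] LinearMap.ker (C.d (i - 1)) := fun i =>
    (C.d i).codRestrict _ (hmem i)
  have hf : ∀ i, Function.Surjective (f i) := by
    rintro i ⟨x, hx⟩
    obtain ⟨y, hy⟩ := (C.exact i x).1 hx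
    exact ⟨y, Subtype.ext hy⟩
  have hker : ∀ i, LinearMap.ker (f i) = LinearMap.ker (C.d i) := fun i =>
    LinearMap.ker_codRestrict _ _ _
  have hext : ∀ i, ∀ g : LinearMap.ker (C.d i) →ₗ[R] R, ∃ g' : C.P i →ₗ[R] R,
      g' ∘ₗ (LinearMap.ker (C.d i)).subtype = g := by
    intro i
    obtain ⟨i, rfl⟩ : ∃ j, i = j - 1 - 1 := ⟨i + 1 + 1, by omega⟩
    intro g
    obtain ⟨g', hg'⟩ := (C.exact_hom i (g ∘ₗ f (i - 1))).1 (by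
      ext x
      have : f (i - 1) (C.d i x) = 0 := Subtype.ext (hmem i x)
      change g (f (i - 1) (C.d i x)) = 0
      rw [this, map_zero])
    refine ⟨g', (LinearMap.cancel_right (hf (i - 1))).1 ?_⟩
    exact hg'
  refine ⟨hext i, ?_⟩
  induction n generalizing i with
  | zero =>
    obtain ⟨i, rfl⟩ : ∃ j, i = j - 1 := ⟨i + 1, by omega⟩
    have := C.projective i
    refine subsingleton_ext_one (hf i) ?_
    rw [hker]
    exact hext i
  | succ n ih =>
    obtain ⟨i, rfl⟩ : ∃ j, i = j - 1 := ⟨i + 1, by omega⟩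
    have := C.projective i
    refine subsingleton_ext_succ (hf i) ?_
    rw [hker]
    exact ih i

theorem IsGorensteinProjective.isExtOrthogonal (h : IsGorensteinProjective R M) :
    IsExtOrthogonal R M := by
  obtain ⟨C, ⟨e⟩⟩ := h
  let f : C.P 0 →ₗ[R] M := e.symm.toLinearMap ∘ₗ (C.d 0).rangeRestrict
  have hf : Function.Surjective f :=
    e.symm.surjective.comp (C.d 0).surjective_rangeRestrict
  have hker : LinearMap.ker f = LinearMap.ker (C.d 0) := by
    rw [LinearMap.ker_comp_of_ker_eq_bot _ e.symm.ker, LinearMap.ker_rangeRestrict]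
  have := C.projective 0
  intro n
  cases n with
  | zero =>
    refine subsingleton_ext_one hf ?_
    rw [hker]
    exact (C.subsingleton_ext_ker 0 0).1
  | succ n =>
    refine subsingleton_ext_succ hf ?_
    rw [hker]
    exact (C.subsingleton_ext_ker n 0).2

end Orthogonal

/-! ### Covers and syzygies of modules orthogonal to the ring -/

section Syzygy

variable {R : Type u} [Ring R] {M P F : Type u} [AddCommGroup M] [Module R M]
  [AddCommGroup P] [Module R P] [AddCommGroup F] [Module R F]

/-- If maps to the ring extend from a submodule, then so do maps to finitely generated projective
modules. -/
theorem exists_extension_projective [Module.Finite R F] [Module.Projective R F]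
    {N : Submodule R P} (h : ∀ g : N →ₗ[R] R, ∃ g' : P →ₗ[R] R, g' ∘ₗ N.subtype = g)
    (g : N →ₗ[R] F) : ∃ g' : P →ₗ[R] F, g' ∘ₗ N.subtype = g := by
  obtain ⟨n, a, b, -, -, hab⟩ := Module.Finite.exists_comp_eq_id_of_projective R F
  choose c hc using fun i => h (LinearMap.proj i ∘ₗ b ∘ₗ g)
  refine ⟨a ∘ₗ LinearMap.pi c, ?_⟩
  have : LinearMap.pi c ∘ₗ N.subtype = b ∘ₗ g := by
    ext x i
    exact LinearMap.congr_fun (hc i) x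
  rw [LinearMap.comp_assoc, this, ← LinearMap.comp_assoc, hab, LinearMap.id_comp]

/-- Over a serial artinian ring, a uniserial module containing a non-zero projective submodule is
projective. -/
theorem IsUniserial.projective_of_submodule (hR : IsSerialArtinian R) (hM : IsUniserial R M)
    (hfl : IsFiniteLength R M) {U : Submodule R M} (hU : U ≠ ⊥) (hproj : Module.Projective R U) :
    Module.Projective R M := by
  have hnt : Nontrivial U := Submodule.nontrivial_iff_ne_bot.2 hU
  have : Nontrivial M := U.injective_subtype.nontrivial
  obtain ⟨T, t, hT, ht⟩ := hM.exists_indecProj hR hfl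
  -- The indecomposable module `V` maps onto the projective `U`, hence bijectively. As `V` contains
  -- `ker t`, the cover `t` is injective.
  let V : Submodule R T := U.comap t
  let s : V →ₗ[R] U := t.restrict fun x hx => hx
  have hs : Function.Surjective s := by
    rintro ⟨y, hy⟩
    obtain ⟨x, rfl⟩ := ht y
    exact ⟨⟨x, hy⟩, rfl⟩
  have hVu : IsUniserial R V := (hT.isUniserial hR).of_injective _ V.injective_subtype
  have : Nontrivial V := hs.nontrivial
  have hb := hVu.isIndecomposable.bijective_of_surjective s hs
  have hinj : Function.Injective t := by
    rw [← LinearMap.ker_eq_bot, LinearMap.ker_eq_bot']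
    intro x hx
    have hxV : x ∈ V := by
      rw [Submodule.mem_comap, hx]
      exact U.zero_mem
    have := @hb.1 ⟨x, hxV⟩ 0 (Subtype.ext (by simpa [s] using hx))
    exact congrArg Subtype.val this
  have := hT.projective
  exact Module.Projective.of_equiv (LinearEquiv.ofBijective t ⟨hinj, ht⟩)

/-- The properties of a non-projective indecomposable semi-Gorenstein-projective module that are
inherited by its syzygies. -/
structure IsStableOrthogonal (R : Type u) [Ring R] (M : Type u) [AddCommGroup M] [Module R M] :
    Prop where
  finiteLength : IsFiniteLength R M
  indecomposable : IsIndecomposable R M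
  not_projective : ¬ Module.Projective R M
  orthogonal : IsExtOrthogonal R M

/-- By orthogonality maps from the kernel `K` to projectives extend to `P`. If `K` were projective,
its identity would extend and split `P`, contradicting indecomposability. -/
theorem IsStableOrthogonal.isMinimalProjective_and_ker (hR : IsSerialArtinian R)
    (hM : IsStableOrthogonal R M) (hP : IsFiniteLength R P) [Module.Projective R P]
    {f : P →ₗ[R] M} (hf : Function.Surjective f) (hk : IsSuperfluous (LinearMap.ker f)) :
    IsMinimalProjective R P ∧ IsStableOrthogonal R (LinearMap.ker f) := by
  have := hM.indecomposable.1
  have hMu := hM.indecomposable.isUniserial hR hM.finiteLength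
  have hPi : IsIndecProj R P :=
    ⟨hP, ‹_›, isIndecomposable_of_isSuperfluous_ker hMu f hf hk⟩
  have hPu := hPi.isUniserial hR
  have := hPi.indecomposable.1
  have := hP.isNoetherian
  have := hP.isArtinian
  have hext := hM.orthogonal.exists_extension hf
  have hbot : LinearMap.ker f ≠ ⊥ := fun h => hM.not_projective
    (Module.Projective.of_equiv (LinearEquiv.ofBijective f ⟨LinearMap.ker_eq_bot.1 h, hf⟩))
  have hnt : Nontrivial (LinearMap.ker f) := Submodule.nontrivial_iff_ne_bot.2 hbot
  have hku : IsUniserial R (LinearMap.ker f) :=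
    hPu.of_injective _ (Submodule.injective_subtype _)
  have hknp : ¬ Module.Projective R (LinearMap.ker f) := by
    intro hkp
    obtain ⟨g, hg⟩ := exists_extension_projective hext LinearMap.id
    have hc := LinearMap.isCompl_of_proj fun x => LinearMap.congr_fun hg x
    rcases hPi.indecomposable.2 _ _ hc with h | h
    · exact hbot h
    · refine hk.ne_top ?_
      have := hc.sup_eq_top
      rwa [h, sup_bot_eq] at this
  refine ⟨⟨hP, ‹_›, hPi.indecomposable, fun N hN hN' hNp => ?_⟩,
    hP.submodule _, hku.isIndecomposable, hknp, hM.orthogonal.ker hf⟩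
  -- If `K ≤ N`, the inclusion extends to a map `P → N`, injective because it is so on `K ≠ 0`; by
  -- finite length `N = P`. If `N ≤ K`, the projective submodule `N` would make `K` projective.
  rcases hPu (LinearMap.ker f) N with h | h
  · obtain ⟨g, hg⟩ := exists_extension_projective hext (Submodule.inclusion h)
    have hinj : Function.Injective (N.subtype ∘ₗ g) := by
      refine hPu.injective_of_injOn hbot _ ?_
      rw [LinearMap.comp_assoc, hg, Submodule.subtype_comp_inclusion]
      exact Submodule.injective_subtype _
    have hsurj := IsArtinian.surjective_of_injective_endomorphism _ hinj
    refine hN' (eq_top_iff.2 fun x _ => ?_)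
    obtain ⟨y, rfl⟩ := hsurj x
    exact (g y).2
  · refine hknp (hku.projective_of_submodule hR (hP.submodule _)
      (U := N.comap (LinearMap.ker f).subtype) ?_ ?_)
    · obtain ⟨x, hx, hx0⟩ := Submodule.exists_mem_ne_zero_of_ne_bot hN
      intro h0
      have : (⟨x, h hx⟩ : LinearMap.ker f) ∈ N.comap (LinearMap.ker f).subtype := hx
      rw [h0, Submodule.mem_bot] at this
      exact hx0 (congrArg Subtype.val this)
    · exact Module.Projective.of_equiv (Submodule.comapSubtypeEquivOfLe h).symm

theorem IsStableOrthogonal.isMinimalProjective_resolution (hR : IsSerialArtinian R)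
    (hM : IsStableOrthogonal R M) (E : MinimalProjectiveResolution R M) (n : ℕ) :
    IsMinimalProjective R (E.P n) := by
  have hmem : ∀ n x, E.d (n + 1) x ∈ LinearMap.ker (E.d n) := fun n x =>
    (E.exact_succ n).linearMap_ker_eq ▸ ⟨x, rfl⟩
  have := E.projective
  obtain ⟨h0, h0'⟩ := hM.isMinimalProjective_and_ker hR (E.finiteLength 0) E.surjective
    E.minimal_zero
  have key : ∀ n, IsMinimalProjective R (E.P (n + 1)) ∧
      IsStableOrthogonal R (LinearMap.ker (E.d n)) := by
    intro n
    induction n with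
    | zero =>
      let f : E.P 1 →ₗ[R] LinearMap.ker E.ε := (E.d 0).codRestrict _ fun x =>
        E.exact_zero.linearMap_ker_eq ▸ ⟨x, rfl⟩
      have hf : Function.Surjective f := by
        rintro ⟨x, hx⟩
        obtain ⟨y, hy⟩ := (E.exact_zero x).1 hx
        exact ⟨y, Subtype.ext hy⟩
      have hker : LinearMap.ker f = LinearMap.ker (E.d 0) := LinearMap.ker_codRestrict _ _ _
      have := h0'.isMinimalProjective_and_ker hR (E.finiteLength 1) hf
        (hker ▸ E.minimal_succ 0)
      rwa [hker] at this
    | succ n ih =>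
      let f : E.P (n + 1 + 1) →ₗ[R] LinearMap.ker (E.d n) :=
        (E.d (n + 1)).codRestrict _ (hmem n)
      have hf : Function.Surjective f := by
        rintro ⟨x, hx⟩
        obtain ⟨y, hy⟩ := (E.exact_succ n x).1 hx
        exact ⟨y, Subtype.ext hy⟩
      have hker : LinearMap.ker f = LinearMap.ker (E.d (n + 1)) :=
        LinearMap.ker_codRestrict _ _ _
      have := ih.2.isMinimalProjective_and_ker hR (E.finiteLength (n + 1 + 1)) hf
        (hker ▸ E.minimal_succ (n + 1))
      rwa [hker] at this
  cases n with
  | zero => exact h0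
  | succ n => exact (key n).1

end Syzygy

/-! ### Minimal resolutions and their periodicity -/

section Resolution

variable {R : Type u} [Ring R] {M : Type u} [AddCommGroup M] [Module R M]

theorem nonempty_minimalProjectiveResolution [IsArtinianRing R] (hM : IsFiniteLength R M) :
    Nonempty (MinimalProjectiveResolution R M) := by
  choose P p hP hproj hsurj hsup using
    fun X : {X : ModuleCat.{u} R // IsFiniteLength R X} => exists_projectiveCover X.2
  let Ω : {X : ModuleCat.{u} R // IsFiniteLength R X} → {X : ModuleCat.{u} R //
    IsFiniteLength R X} := fun X => ⟨ModuleCat.of R (LinearMap.ker (p X)), (hP X).submodule _⟩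
  let Z : ℕ → {X : ModuleCat.{u} R // IsFiniteLength R X} := fun n =>
    Ω^[n] ⟨ModuleCat.of R M, hM⟩
  have hZ : ∀ n, Z (n + 1) = Ω (Z n) := fun n => Function.iterate_succ_apply' Ω n _
  have hd : ∀ n, ∃ d : P (Z (n + 1)) →ₗ[R] P (Z n),
      LinearMap.range d = LinearMap.ker (p (Z n)) ∧
      LinearMap.ker d = LinearMap.ker (p (Z (n + 1))) := by
    intro n
    rw [hZ]
    let q : P (Ω (Z n)) →ₗ[R] LinearMap.ker (p (Z n)) := p (Ω (Z n))
    have hq : Function.Surjective q := hsurj (Ω (Z n))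
    refine ⟨(LinearMap.ker (p (Z n))).subtype ∘ₗ q, ?_, ?_⟩
    · rw [LinearMap.range_comp, LinearMap.range_eq_top.2 hq, Submodule.map_top,
        Submodule.range_subtype]
    · exact LinearMap.ker_comp_of_ker_eq_bot q (Submodule.ker_subtype _)
  choose d hrange hker using hd
  have hexact : Function.Exact (d 0) (p (Z 0)) := LinearMap.exact_iff.2 (hrange 0).symm
  exact ⟨⟨fun n => P (Z n), d, p (Z 0), fun n => hP _, fun n => hproj _, hsurj _,
    hexact, fun n => LinearMap.exact_iff.2 (by rw [hker, hrange]), hsup _,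
    fun n => by rw [hker]; exact hsup _⟩⟩

/-- The modules of the augmented resolution `⋯ → P 1 → P 0 → M`. -/
def MinimalProjectiveResolution.augmented (E : MinimalProjectiveResolution R M) :
    ℕ → ModuleCat.{u} R
  | 0 => ModuleCat.of R M
  | n + 1 => E.P n

/-- The maps of the augmented resolution `⋯ → P 1 → P 0 → M`. -/
def MinimalProjectiveResolution.augmentedMap (E : MinimalProjectiveResolution R M) :
    ∀ n, E.augmented (n + 1) →ₗ[R] E.augmented n
  | 0 => E.ε
  | n + 1 => E.d n

theorem MinimalProjectiveResolution.ker_augmentedMap (E : MinimalProjectiveResolution R M) :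
    ∀ n, LinearMap.ker (E.augmentedMap n) = LinearMap.range (E.augmentedMap (n + 1))
  | 0 => E.exact_zero.linearMap_ker_eq
  | n + 1 => (E.exact_succ n).linearMap_ker_eq

theorem MinimalProjectiveResolution.isSuperfluous_ker_augmentedMap
    (E : MinimalProjectiveResolution R M) :
    ∀ n, IsSuperfluous (LinearMap.ker (E.augmentedMap n))
  | 0 => E.minimal_zero
  | n + 1 => E.minimal_succ n

theorem MinimalProjectiveResolution.range_augmentedMap_zero
    (E : MinimalProjectiveResolution R M) : LinearMap.range (E.augmentedMap 0) = ⊤ :=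
  LinearMap.range_eq_top.2 E.surjective

theorem MinimalProjectiveResolution.nonempty_range_augmentedMap_zero
    (E : MinimalProjectiveResolution R M) :
    Nonempty (LinearMap.range (E.augmentedMap 0) ≃ₗ[R] M) :=
  ⟨LinearEquiv.ofTop _ E.range_augmentedMap_zero⟩

/-- A minimal projective resolution of a non-projective module whose non-zero terms are minimal
projective does not terminate, and its syzygies are not projective. -/
theorem MinimalProjectiveResolution.syzygy_nontrivial (E : MinimalProjectiveResolution R M)
    [Nontrivial M] (hM : ¬ Module.Projective R M)
    (hE : ∀ n, Nontrivial (E.P n) → IsMinimalProjective R (E.P n)) (n : ℕ) :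
    Nontrivial (LinearMap.range (E.augmentedMap n)) ∧
      ¬ Module.Projective R (LinearMap.range (E.augmentedMap n)) := by
  induction n with
  | zero =>
    obtain ⟨e⟩ := E.nonempty_range_augmentedMap_zero
    exact ⟨e.toEquiv.nontrivial, fun h => hM (Module.Projective.of_equiv e)⟩
  | succ n ih =>
    obtain ⟨h1, h2⟩ := ih
    have hnt : Nontrivial (E.P n) := (E.augmentedMap n).surjective_rangeRestrict.nontrivial
    have hproj : Module.Projective R (E.augmented (n + 1)) := E.projective n
    have hne : LinearMap.ker (E.augmentedMap n) ≠ ⊥ := fun h => h2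
      (Module.Projective.of_equiv
        (LinearEquiv.ofInjective (E.augmentedMap n) (LinearMap.ker_eq_bot.1 h)))
    have hne' : LinearMap.ker (E.augmentedMap n) ≠ ⊤ :=
      IsSuperfluous.ne_top (M := E.P n) (E.isSuperfluous_ker_augmentedMap n)
    rw [← E.ker_augmentedMap]
    exact ⟨Submodule.nontrivial_iff_ne_bot.2 hne, (hE n hnt).minimal _ hne hne'⟩

/-- A serial artinian ring has only finitely many indecomposable projective modules. -/
theorem exists_finite_indecProj (hR : IsSerialArtinian R) :
    ∃ S : Set (Submodule R R), S.Finite ∧ (∀ B ∈ S, IsIndecProj R B) ∧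
      ∀ (Q : Type u) [AddCommGroup Q] [Module R Q], IsIndecProj R Q →
        ∃ B ∈ S, Nonempty (B ≃ₗ[R] Q) := by
  have := hR.artinian
  obtain ⟨S, hS, hind, htop⟩ : ∃ S : Set (Submodule R R), S.Finite ∧
      (∀ B ∈ S, IsIndecProj R B) ∧ sSup S = ⊤ := by
    refine induction_of_isCompl (fun A => ∃ S : Set (Submodule R R), S.Finite ∧
      (∀ B ∈ S, IsIndecProj R B) ∧ sSup S = A) ⟨∅, by simp⟩ ?_ ?_
    · intro A B hAB hA
      refine ⟨{A}, Set.finite_singleton A, ?_, sSup_singleton⟩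
      rintro _ rfl
      exact ⟨IsFiniteLength.submodule isFiniteLength_of_finite _, projective_of_isCompl hAB, hA⟩
    · rintro _ _ C - ⟨S, hS, hS', rfl⟩ ⟨S', hT, hT', rfl⟩
      exact ⟨S ∪ S', hS.union hT, fun B hB => hB.elim (hS' B) (hT' B), sSup_union⟩
  refine ⟨S, hS, hind, fun Q _ _ hQ => ?_⟩
  have := hQ.indecomposable.1
  have := hQ.projective
  have hQu := hQ.isUniserial hR
  obtain ⟨i, r, hri⟩ := hQu.exists_retract hQ.finiteLength
  obtain ⟨m, hm, hm'⟩ := hQu.exists_greatest_ne_top hQ.finiteLength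
  -- The summands generate `R`, so not all of them can map into the largest proper submodule of `Q`;
  -- one that does not maps onto `Q`.
  obtain ⟨B, hB, hBr⟩ : ∃ B ∈ S, B.map r = ⊤ := by
    by_contra! H
    refine hm (eq_top_iff.2 ?_)
    have hle : sSup S ≤ m.comap r := sSup_le fun B hB =>
      Submodule.map_le_iff_le_comap.1 (hm' _ (H B hB))
    rw [htop] at hle
    intro x _
    rw [← LinearMap.id_apply (R := R) x, ← hri]
    exact hle (Submodule.mem_top (x := i x))
  refine ⟨B, hB, ⟨LinearEquiv.ofBijective (r ∘ₗ B.subtype)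
    ((hind B hB).indecomposable.bijective_of_surjective _ ?_)⟩⟩
  rw [← LinearMap.range_eq_top, LinearMap.range_comp, Submodule.range_subtype, hBr]

/-- The submodules form a chain that is well-founded in both directions. -/
theorem IsUniserial.finite_submodule (hM : IsUniserial R M) (hfl : IsFiniteLength R M) :
    Finite (Submodule R M) := by
  have := hfl.isNoetherian
  have := hfl.isArtinian
  let _ : LinearOrder (Submodule R M) :=
    { (inferInstance : PartialOrder (Submodule R M)) with
      le_total := hM
      toDecidableLE := Classical.decRel _
      min_def := fun a b => by
        split_ifs with h
        exacts [inf_eq_left.2 h, inf_eq_right.2 ((hM a b).resolve_left h)]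
      max_def := fun a b => by
        split_ifs with h
        exacts [sup_eq_right.2 h, sup_eq_left.2 ((hM a b).resolve_left h)] }
  exact @Finite.of_wellFoundedLT_wellFoundedGT (Submodule R M) _
    ⟨(wellFounded_lt (α := Submodule R M))⟩ ⟨(wellFounded_gt (α := Submodule R M))⟩

/-- Among infinitely many quotients of indecomposable projective modules, two are isomorphic. -/
theorem exists_lt_nonempty_equiv (hR : IsSerialArtinian R) (Q X : ℕ → ModuleCat.{u} R)
    (q : ∀ n, Q n →ₗ[R] X n) (hQ : ∀ n, IsIndecProj R (Q n))
    (hq : ∀ n, Function.Surjective (q n)) : ∃ i j, i < j ∧ Nonempty (X i ≃ₗ[R] X j) := by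
  obtain ⟨S, hS, hind, hex⟩ := exists_finite_indecProj hR
  have := hS.to_subtype
  have : ∀ B : S, Finite (Submodule R B.1) := fun B =>
    ((hind B B.2).isUniserial hR).finite_submodule (hind B B.2).finiteLength
  -- Each `X n` is coded by one of finitely many pairs of an indecomposable projective and a
  -- submodule; pigeonhole applies.
  have hc : ∀ n, ∃ c : Σ B : S, Submodule R B.1, Nonempty ((c.1.1 ⧸ c.2) ≃ₗ[R] X n) := by
    intro n
    obtain ⟨B, hB, ⟨e⟩⟩ := hex (Q n) (hQ n)
    exact ⟨⟨⟨B, hB⟩, LinearMap.ker (q n ∘ₗ e.toLinearMap)⟩,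
      ⟨(q n ∘ₗ e.toLinearMap).quotKerEquivOfSurjective ((hq n).comp e.surjective)⟩⟩
  choose c hc using hc
  obtain ⟨i, j, hij, hcij⟩ := Finite.exists_ne_map_eq_of_infinite c
  have key : ∀ i j, c i = c j → Nonempty (X i ≃ₗ[R] X j) := by
    intro i j h
    obtain ⟨e⟩ := hc i
    obtain ⟨e'⟩ := hc j
    rw [← h] at e'
    exact ⟨e.symm.trans e'⟩
  rcases lt_or_gt_of_ne hij with h | h
  · exact ⟨i, j, h, key i j hcij⟩
  · exact ⟨j, i, h, key j i hcij.symm⟩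

/-- A module with minimal projective cover is determined by its syzygy. -/
theorem IsMinimalProjective.nonempty_equiv_of_ker_equiv (hR : IsSerialArtinian R)
    {P Q X Y : Type u} [AddCommGroup P] [Module R P] [AddCommGroup Q] [Module R Q]
    [AddCommGroup X] [Module R X] [AddCommGroup Y] [Module R Y] (hP : IsMinimalProjective R P)
    (hQ : IsMinimalProjective R Q) {f : P →ₗ[R] X} (hf : Function.Surjective f)
    {g : Q →ₗ[R] Y} (hg : Function.Surjective g) (hker : LinearMap.ker f ≠ ⊥)
    (e : LinearMap.ker f ≃ₗ[R] LinearMap.ker g) : Nonempty (X ≃ₗ[R] Y) := by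
  -- The isomorphism of kernels extends to `P → Q`. It is injective as `ker f ≠ 0` and bijective by
  -- minimality of `Q`, so it induces an isomorphism of the quotients.
  obtain ⟨γ, hγ⟩ := hP.exists_extension_indecProj hR hQ.isIndecProj _
    ((LinearMap.ker g).subtype ∘ₗ e.toLinearMap)
  have hinj : Function.Injective γ :=
    (hP.isIndecProj.isUniserial hR).injective_of_injOn hker γ
      (by rw [hγ]; exact (Submodule.injective_subtype _).comp e.injective)
  have := hP.projective
  have := hP.indecomposable.1
  let γ' := LinearEquiv.ofBijective γ (hQ.bijective_of_injective γ hinj)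
  have hmap : (LinearMap.ker f).map (γ' : P →ₗ[R] Q) = LinearMap.ker g := by
    change (LinearMap.ker f).map γ = LinearMap.ker g
    have := congrArg LinearMap.range hγ
    rwa [LinearMap.range_comp, Submodule.range_subtype, LinearMap.range_comp,
      LinearEquiv.range, Submodule.map_top, Submodule.range_subtype] at this
  exact ⟨(f.quotKerEquivOfSurjective hf).symm.trans
    ((Submodule.Quotient.equiv _ _ γ' hmap).trans (g.quotKerEquivOfSurjective hg))⟩

/-- Cut off an augmented resolution after `n` projective terms. -/
theorem hasPeriodic_of_syzygy_equiv (E : MinimalProjectiveResolution R M)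
    (hE : ∀ n, IsMinimalProjective R (E.P n)) {n : ℕ} (hn : 1 ≤ n)
    (e : LinearMap.range (E.augmentedMap n) ≃ₗ[R] M) :
    HasPeriodicMinimalProjectiveSequence R M := by
  classical
  let X : ℕ → ModuleCat.{u} R := fun i => if i ≤ n then E.augmented i else ModuleCat.of R M
  have hX : ∀ i, i ≤ n → X i = E.augmented i := fun i hi => if_pos hi
  have hXn : X (n + 1) = ModuleCat.of R M := if_neg (by omega)
  let a : ∀ i, i ≤ n → (X i ≃ₗ[R] E.augmented i) := fun i hi =>
    (CategoryTheory.eqToIso (hX i hi)).toLinearEquiv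
  let b : X (n + 1) ≃ₗ[R] M := (CategoryTheory.eqToIso hXn).toLinearEquiv
  -- Below `n` these are the resolution maps, transported along `a`; at `n` the map embeds `M` as
  -- the `n`-th syzygy.
  have hf : ∀ i, ∃ f : X (i + 1) →ₗ[R] X i,
      (∀ h : i ≤ n, LinearMap.range f =
        (LinearMap.range (E.augmentedMap i)).comap (a i h).toLinearMap) ∧
      (∀ h : i + 1 ≤ n, LinearMap.ker f =
        (LinearMap.ker (E.augmentedMap i)).comap (a (i + 1) h).toLinearMap) ∧
      (i = n → Function.Injective f) := by
    intro i
    rcases lt_trichotomy i n with h | rfl | h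
    · refine ⟨(a i h.le).symm.toLinearMap ∘ₗ E.augmentedMap i ∘ₗ (a (i + 1) h).toLinearMap,
        fun _ => ?_, fun _ => ?_, fun h' => absurd h' h.ne⟩
      · rw [LinearMap.range_comp, LinearMap.range_comp, LinearEquiv.range, Submodule.map_top]
        exact Submodule.map_equiv_eq_comap_symm _ _
      · rw [LinearMap.ker_comp_of_ker_eq_bot _ (LinearEquiv.ker _), LinearMap.ker_comp]
    · refine ⟨(a i le_rfl).symm.toLinearMap ∘ₗ (LinearMap.range (E.augmentedMap i)).subtype ∘ₗ
        (b.trans e.symm).toLinearMap, fun _ => ?_, fun h => absurd h (by omega), fun _ => ?_⟩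
      · rw [LinearMap.range_comp, LinearMap.range_comp, LinearEquiv.range, Submodule.map_top,
          Submodule.range_subtype]
        exact Submodule.map_equiv_eq_comap_symm _ _
      · exact (a i le_rfl).symm.injective.comp
          ((Submodule.injective_subtype _).comp (b.trans e.symm).injective)
    · exact ⟨0, fun h' => absurd h' (by omega), fun h' => absurd h' (by omega),
        fun h' => absurd h' (by omega)⟩
  choose f hrange hker hinj using hf
  refine ⟨n, X, f, hn, ⟨a 0 (Nat.zero_le n)⟩, ⟨b⟩, fun i hi => ?_, ?_, fun i hi => ?_,
    hinj n rfl⟩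
  · rw [hX (i + 1) hi]
    exact hE i
  · rw [← LinearMap.range_eq_top, hrange 0 (Nat.zero_le n), E.range_augmentedMap_zero,
      Submodule.comap_top]
  · rw [LinearMap.exact_iff, hker i hi, hrange (i + 1) hi, E.ker_augmentedMap]

/-- A minimal projective resolution with minimal projective terms is periodic. -/
theorem hasPeriodic_of_isMinimalProjective (hR : IsSerialArtinian R) [Nontrivial M]
    (hM : ¬ Module.Projective R M) (E : MinimalProjectiveResolution R M)
    (hE : ∀ n, Nontrivial (E.P n) → IsMinimalProjective R (E.P n)) :
    HasPeriodicMinimalProjectiveSequence R M := by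
  have hsyz := E.syzygy_nontrivial hM hE
  have hmin : ∀ n, IsMinimalProjective R (E.P n) := fun n =>
    hE n (have := (hsyz n).1; (E.augmentedMap n).surjective_rangeRestrict.nontrivial)
  obtain ⟨i, j, hij, heq⟩ := exists_lt_nonempty_equiv hR E.P
    (fun n => ModuleCat.of R (LinearMap.range (E.augmentedMap n)))
    (fun n => (E.augmentedMap n).rangeRestrict) (fun n => (hmin n).isIndecProj)
    (fun n => (E.augmentedMap n).surjective_rangeRestrict)
  obtain ⟨k, rfl⟩ := Nat.exists_eq_add_of_lt hij
  have hcancel : ∀ i j, Nonempty (LinearMap.range (E.augmentedMap (i + 1)) ≃ₗ[R]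
      LinearMap.range (E.augmentedMap (j + 1))) →
      Nonempty (LinearMap.range (E.augmentedMap i) ≃ₗ[R]
        LinearMap.range (E.augmentedMap j)) := by
    rintro i j ⟨e⟩
    have hk : ∀ i, LinearMap.ker (E.augmentedMap i).rangeRestrict =
        LinearMap.range (E.augmentedMap (i + 1)) := fun i => by
      rw [LinearMap.ker_rangeRestrict, E.ker_augmentedMap]
    rw [← hk, ← hk] at e
    refine (hmin i).nonempty_equiv_of_ker_equiv hR (hmin j)
      (E.augmentedMap i).surjective_rangeRestrict (E.augmentedMap j).surjective_rangeRestrict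
      (fun h => ?_) e
    exact Submodule.nontrivial_iff_ne_bot.1 (hsyz (i + 1)).1 ((hk i).symm.trans h)
  -- Cancelling one syzygy at a time keeps the distance `k + 1`, which becomes the period.
  have hdesc : ∀ i m, m = i + (k + 1) → Nonempty (LinearMap.range (E.augmentedMap i) ≃ₗ[R]
      LinearMap.range (E.augmentedMap m)) →
      Nonempty (LinearMap.range (E.augmentedMap 0) ≃ₗ[R]
        LinearMap.range (E.augmentedMap (k + 1))) := by
    intro i
    induction i with
    | zero =>
      intro m hm
      obtain rfl : m = k + 1 := by omega
      exact id
    | succ i ih =>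
      intro m hm h
      obtain ⟨m, rfl⟩ : ∃ m', m = m' + 1 := ⟨i + (k + 1), by omega⟩
      exact ih m (by omega) (hcancel _ _ h)
  obtain ⟨e⟩ := hdesc i _ rfl heq
  obtain ⟨e₀⟩ := E.nonempty_range_augmentedMap_zero
  exact hasPeriodic_of_syzygy_equiv E hmin (Nat.succ_pos k) (e.symm.trans e₀)

end Resolution

end NakayamaGP

/-! ### The equivalences -/

theorem proposition4 {k : Type v} {Λ : Type u} [CommRing k] [Ring Λ] [Algebra k Λ]
    (hΛ : NakayamaGP.IsNakayamaAlgebra k Λ) (hsimple : NakayamaGP.NoSimpleProjective Λ)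
    {M : Type u} [AddCommGroup M] [Module Λ M] (hM : IsFiniteLength Λ M)
    (hind : NakayamaGP.IsIndecomposable Λ M) (hnonproj : ¬ Module.Projective Λ M) :
    List.TFAE [
      -- `M` is Gorenstein projective
      NakayamaGP.IsGorensteinProjective Λ M,
      -- in every minimal projective resolution of `M`, all terms are minimal projective
      ∀ R : NakayamaGP.MinimalProjectiveResolution Λ M,
        ∀ n, NakayamaGP.IsMinimalProjective Λ (R.P n),
      -- in some minimal projective resolution of `M`, all non-zero terms are minimal projective
      ∃ R : NakayamaGP.MinimalProjectiveResolution Λ M,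
        ∀ n, Nontrivial (R.P n) → NakayamaGP.IsMinimalProjective Λ (R.P n),
      -- there is a sequence `0 → M → P_{n-1} → ⋯ → P_0 → M → 0` with minimal projective `P_i`
      NakayamaGP.HasPeriodicMinimalProjectiveSequence Λ M] := by
  have hR := hΛ.isSerialArtinian
  have := hR.artinian
  have := hind.1
  tfae_have 1 → 2 := fun h => NakayamaGP.IsStableOrthogonal.isMinimalProjective_resolution hR
    ⟨hM, hind, hnonproj, h.isExtOrthogonal⟩
  tfae_have 2 → 3 := fun h => by
    obtain ⟨E⟩ := NakayamaGP.nonempty_minimalProjectiveResolution hM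
    exact ⟨E, fun n _ => h E n⟩
  tfae_have 3 → 4 := fun ⟨E, hE⟩ =>
    NakayamaGP.hasPeriodic_of_isMinimalProjective hR hnonproj E hE
  tfae_have 4 → 1 := fun h => h.isGorensteinProjective hR
  tfae_finish
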